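/- Let $M>0$ and $0<e^2<M^2$, let $h(r)=1-\frac{2M}{r}+\frac{e^2}{r^2}$, with roots $r_\pm=M\pm\sqrt{M^2-e^2}$, let $\kappa_\pm=\frac{r_+-r_-}{2r_\pm^2}$, and let $r^*(r)=r+\frac{1}{2\kappa_+}\log\left|1-\frac r{r_+}\right|-\frac1{2\kappa_-}\log\left|1-\frac r{r_-}\right|$ be the primitive of $1/h$ with $r^*(0)=0$. **The Penrose diagram.** The maximally extended Reissner–Nordström spacetime with metric $-h\,dt^2+h^{-1}dr^2+r^2(d\theta^2+\sin^2\theta\,d\phi^2)$ is described in global conformal coordinates $(T,X)$, $v=T+X$, $w=T-X$, as follows. Let $F$ be a real function, even and $2\pi$-periodic, such that $x_+(v)=\operatorname{sgn}(\sin\frac v2)\,e^{\kappa_+F(v)}$ is $C^\infty$ with positive derivative on $(-\pi,\pi)$ and $x_-(v)=-\operatorname{sgn}(\cos\frac v2)\,e^{-\kappa_-F(v)}$ is $C^\infty$ with positive derivative on $(0,2\pi)$, where $\operatorname{sgn}0=0$ (for example $F(v)=\frac1{\kappa_+}\log|\sin\frac v2|-\frac1{\kappa_-}\log|\cos\frac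 v2|$, the value at multiples of $\pi$ being irrelevant). The diagram $\mathcal Q\subset\mathbb R^2$ is the union over $k\in\mathbb Z$ of the squares $v,w\in((2k-1)\pi,(2k+1)\pi)$ (regions I, II, I$'$, II$'$ around a bifurcation sphere $r=r_+$) and of the parts of the squares $v,w\in(2k\pi,(2k+2)\pi)$ where $-x_-(v)x_-(w)<1$, that is, $r>0$ (regions II, III, II$'$, III$'$ around a bifurcation sphere $r=r_-$). The lines $v\in\pi\mathbb Z$ and $w\in\pi\mathbb Z$ are the horizons $r=r_\pm$. Off the horizons, $r$ is given by $r^*(r)=\frac12(F(v)+F(w))$, with $r>r_+$ in I, I$'$, $r_-<r<r_+$ in II, II$'$ and $0<r<r_-$ in III, III$'$, and the metric is $$\Omega^2(-dT^2+dX^2)+r^2(d\theta^2+\sin^2\theta\,d\phi^2),\qquad \Omega^2=-h(r)F'(v)F'(w)>0;$$ $r$ and $\Omega^2$ extend smoothly across the horizons. The vector field $\partial_T$ is future directed. **Solutions.** Mean curvature is one third of the trace of the second fundamental form with respect to the future directed unit normal $\nu$, that is, $\frac13\operatorname{div}\nu$. Given $H\in\mathbb R$, $(T_0,X_0)\in\mathcal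 Q$ and $V$ with $1-V^2>0$, a solution on an open interval $J\ni X_0$ is a $C^2$ function $S:J\to\mathbb R$ with $S(X_0)=T_0$, $S'(X_0)=V$, $(S(X),X)\in\mathcal Q$ for $X\in J$, such that the spherically symmetric hypersurface $(S(X),X,\theta,\phi)$, $X\in J$, is spacelike with constant mean curvature $H$. **Theorem 1.** For all such $M,e,F,H,(T_0,X_0),V$ there is a solution $T$ on an open interval $I\ni X_0$ such that: 1. $T$ is $C^\infty$ on $I$ and $1-T'(X)^2>0$ for all $X\in I$; 2. the hypersurface is inextendible: the curve $\{(T(X),X):X\in I\}$ is closed in $\mathcal Q$, so it does not end at any point of the spacetime, in particular not at a horizon; 3. $T$ is unique: if $S$ is a solution on an open interval $J\ni X_0$, then $J\subseteq I$ and $S=T$ on $J$. -/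

import Mathlib

open Set
open scoped ContDiff

noncomputable section

namespace ReissnerNordstrom

/-! ### Horizons, surface gravities, the function `h` -/

/-- Outer horizon radius. -/
def rPlus (M e : ℝ) : ℝ := M + Real.sqrt (M ^ 2 - e ^ 2)

/-- Inner horizon radius. -/
def rMinus (M e : ℝ) : ℝ := M - Real.sqrt (M ^ 2 - e ^ 2)

/-- `h(r) = 1 - 2M/r + e²/r²`; the metric in standard coordinates is
`-h dt² + dr²/h + r² (dθ² + sin²θ dφ²)`. -/
def lapse (M e r : ℝ) : ℝ := 1 - 2 * M / r + e ^ 2 / r ^ 2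

/-- Absolute value `|h'(r₊)| / 2` of the surface gravity at `r₊`. -/
def kPlus (M e : ℝ) : ℝ := (rPlus M e - rMinus M e) / (2 * rPlus M e ^ 2)

/-- Absolute value `|h'(r₋)| / 2` of the surface gravity at `r₋`. -/
def kMinus (M e : ℝ) : ℝ := (rPlus M e - rMinus M e) / (2 * rMinus M e ^ 2)

/-- The tortoise coordinate, the primitive of `1/h` with `r*(0) = 0`, the same constant of
integration being used in all regions:
`r* = r + log|1 - r/r₊| / (2κ₊) - log|1 - r/r₋| / (2κ₋)`. -/
def tortoise (M e r : ℝ) : ℝ :=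
  r + Real.log |1 - r / rPlus M e| / (2 * kPlus M e)
    - Real.log |1 - r / rMinus M e| / (2 * kMinus M e)

/-! ### The maximal extension in null coordinates

Throughout, `v = T + X` and `w = T - X`.  The lines `v ∈ πℤ` and `w ∈ πℤ` are the horizons and cut
the diagram into blocks of side `π`.  A function `F`, the "profile", gives the
Eddington-Finkelstein time as a function of `v` and `w` in each block; in each block
`r* = (F v + F w) / 2`, `t = ± (F v - F w) / 2`, so that
`-h dt² + dr²/h = h (-dt² + dr*²) = -h F'(v) F'(w) (-dT² + dX²)`.

The squares centred at `(v, w) = (2kπ, 2kπ)` are the Kruskal patches around the bifurcation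
spheres `r = r₊` (four blocks I, II, I', II'), the squares centred at `((2k+1)π, (2k+1)π)` are
the Kruskal patches around the bifurcation spheres `r = r₋` (four blocks II, III, II', III', the
blocks III and III' being cut off at the singularity `r = 0`). -/

/-- Kruskal null coordinate regular at the outer horizons. -/
def xPlus (M e : ℝ) (F : ℝ → ℝ) (v : ℝ) : ℝ :=
  Real.sign (Real.sin (v / 2)) * Real.exp (kPlus M e * F v)

/-- Kruskal null coordinate regular at the inner horizons. -/
def xMinus (M e : ℝ) (F : ℝ → ℝ) (v : ℝ) : ℝ :=
  -Real.sign (Real.cos (v / 2)) * Real.exp (-kMinus M e * F v)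

/-- `F` is the profile of a smooth Penrose diagram, symmetric about both axes and periodic in time:
the Kruskal coordinates at both kinds of horizons are smooth regular functions of the null
coordinate of the diagram.  For instance
`F v = log|sin (v/2)| / κ₊ - log|cos (v/2)| / κ₋` is such a profile. -/
structure IsPenroseProfile (M e : ℝ) (F : ℝ → ℝ) : Prop where
  even : ∀ v, F (-v) = F v
  periodic : ∀ v, F (v + 2 * Real.pi) = F v
  smooth_plus : ContDiffOn ℝ ∞ (xPlus M e F) (Ioo (-Real.pi) Real.pi)
  deriv_plus_pos : ∀ v ∈ Ioo (-Real.pi) Real.pi, 0 < deriv (xPlus M e F) v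
  smooth_minus : ContDiffOn ℝ ∞ (xMinus M e F) (Ioo 0 (2 * Real.pi))
  deriv_minus_pos : ∀ v ∈ Ioo 0 (2 * Real.pi), 0 < deriv (xMinus M e F) v

/-- `v` and `w` lie in a common square around a bifurcation sphere `r = r₊`. -/
def PlusPatch (v w : ℝ) : Prop :=
  ∃ k : ℤ, v ∈ Ioo ((2 * k - 1) * Real.pi) ((2 * k + 1) * Real.pi) ∧
    w ∈ Ioo ((2 * k - 1) * Real.pi) ((2 * k + 1) * Real.pi)

/-- `v` and `w` lie in a common square around a bifurcation sphere `r = r₋`. -/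
def MinusPatch (v w : ℝ) : Prop :=
  ∃ k : ℤ, v ∈ Ioo (2 * k * Real.pi) ((2 * k + 2) * Real.pi) ∧
    w ∈ Ioo (2 * k * Real.pi) ((2 * k + 2) * Real.pi)

/-- `± exp (2 κ₊ r*)`, with the sign of `r - r₊`, for `r > r₋`; an increasing
bijection from `(r₋, ∞)` onto `ℝ`. -/
def radialPlus (M e r : ℝ) : ℝ :=
  (r / rPlus M e - 1) * Real.exp (2 * kPlus M e * r)
    * (r / rMinus M e - 1) ^ (-(kPlus M e / kMinus M e))

/-- `± exp (-2 κ₋ r*)`, with the sign of `r₋ - r`, for `0 < r < r₊`; a decreasing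
bijection from `(0, r₊)` onto `(-∞, 1)`. -/
def radialMinus (M e r : ℝ) : ℝ :=
  (1 - r / rMinus M e) * Real.exp (-2 * kMinus M e * r)
    * (1 - r / rPlus M e) ^ (-(kMinus M e / kPlus M e))

/-- `h / radialPlus`, with the common zero at `r₊` cancelled. -/
def quotPlus (M e r : ℝ) : ℝ :=
  rPlus M e * rMinus M e / r ^ 2 * Real.exp (-2 * kPlus M e * r)
    * (r / rMinus M e - 1) ^ (1 + kPlus M e / kMinus M e)

/-- `h / radialMinus`, with the common zero at `r₋` cancelled. -/
def quotMinus (M e r : ℝ) : ℝ :=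
  rPlus M e * rMinus M e / r ^ 2 * Real.exp (2 * kMinus M e * r)
    * (1 - r / rPlus M e) ^ (1 + kMinus M e / kPlus M e)

/-- The Penrose diagram of the maximally extended spacetime, as a set of points `(T, X)`.  In a
patch around `r = r₋` the condition `-x₋(v) x₋(w) < 1` says `r > 0`. -/
def penroseDiagram (M e : ℝ) (F : ℝ → ℝ) : Set (ℝ × ℝ) :=
  {p | PlusPatch (p.1 + p.2) (p.1 - p.2) ∨
    (MinusPatch (p.1 + p.2) (p.1 - p.2) ∧
      -(xMinus M e F (p.1 + p.2) * xMinus M e F (p.1 - p.2)) < 1)}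

open Classical in
/-- The area radius `r` as a function of the null coordinates, i.e. the solution of
`radialPlus r = -x₊(v) x₊(w)`, respectively `radialMinus r = -x₋(v) x₋(w)` (the two agree where
the patches overlap, both being `r* = (F v + F w) / 2`). -/
def radius (M e : ℝ) (F : ℝ → ℝ) (v w : ℝ) : ℝ :=
  if PlusPatch v w then
    Function.invFunOn (radialPlus M e) (Ioi (rMinus M e)) (-(xPlus M e F v * xPlus M e F w))
  else
    Function.invFunOn (radialMinus M e) (Ioo 0 (rPlus M e)) (-(xMinus M e F v * xMinus M e F w))

open Classical in
/-- The conformal factor `Ω²`: it is `-h(r) F'(v) F'(w)` off the horizons, written in the Kruskal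
coordinates so that it makes sense on the horizons too. -/
def confFactor (M e : ℝ) (F : ℝ → ℝ) (v w : ℝ) : ℝ :=
  if PlusPatch v w then
    quotPlus M e (radius M e F v w) * deriv (xPlus M e F) v * deriv (xPlus M e F) w
      / kPlus M e ^ 2
  else
    quotMinus M e (radius M e F v w) * deriv (xMinus M e F) v * deriv (xMinus M e F) w
      / kMinus M e ^ 2

/-- The spacetime metric `Ω² (-dT² + dX²) + r² (dθ² + sin²θ dφ²)` in the coordinates
`y = (T, X, θ, φ)`. -/
def metric (M e : ℝ) (F : ℝ → ℝ) (y : Fin 4 → ℝ) : Matrix (Fin 4) (Fin 4) ℝ :=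
  Matrix.diagonal
    ![-confFactor M e F (y 0 + y 1) (y 0 - y 1),
      confFactor M e F (y 0 + y 1) (y 0 - y 1),
      radius M e F (y 0 + y 1) (y 0 - y 1) ^ 2,
      radius M e F (y 0 + y 1) (y 0 - y 1) ^ 2 * Real.sin (y 2) ^ 2]

end ReissnerNordstrom

/-! ### Mean curvature of a spacelike hypersurface in a coordinate chart -/

namespace LorentzChart

/-- Partial derivative in the `i`-th coordinate direction. -/
def pderiv {n : ℕ} {E : Type*} [NormedAddCommGroup E] [NormedSpace ℝ E]
    (f : (Fin n → ℝ) → E) (i : Fin n) (u : Fin n → ℝ) : E :=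
  fderiv ℝ f u (Pi.single i 1)

/-- Christoffel symbols of the first kind,
`Γ_{l,ab} = (∂_a g_{bl} + ∂_b g_{al} - ∂_l g_{ab}) / 2`. -/
def christoffel (g : (Fin 4 → ℝ) → Matrix (Fin 4) (Fin 4) ℝ) (y : Fin 4 → ℝ)
    (l a b : Fin 4) : ℝ :=
  (pderiv (fun z => g z b l) a y + pderiv (fun z => g z a l) b y
    - pderiv (fun z => g z a b) l y) / 2

/-- The induced metric `g(∂_i Φ, ∂_j Φ)`. -/
def firstForm (g : (Fin 4 → ℝ) → Matrix (Fin 4) (Fin 4) ℝ) (Φ : (Fin 3 → ℝ) → (Fin 4 → ℝ))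
    (u : Fin 3 → ℝ) : Matrix (Fin 3) (Fin 3) ℝ :=
  Matrix.of fun i j => pderiv Φ i u ⬝ᵥ (g (Φ u)).mulVec (pderiv Φ j u)

/-- The second fundamental form `-g(ν, ∇_i ∂_j Φ) = g(∇_i ν, ∂_j Φ)` with respect to the normal
vector `ν` at the point `Φ u`. -/
def secondForm (g : (Fin 4 → ℝ) → Matrix (Fin 4) (Fin 4) ℝ) (Φ : (Fin 3 → ℝ) → (Fin 4 → ℝ))
    (ν : Fin 4 → ℝ) (u : Fin 3 → ℝ) : Matrix (Fin 3) (Fin 3) ℝ :=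
  Matrix.of fun i j =>
    -(ν ⬝ᵥ (g (Φ u)).mulVec (pderiv (fun z => pderiv Φ j z) i u)
      + ∑ l, ∑ a, ∑ b, christoffel g (Φ u) l a b * ν l * pderiv Φ i u a * pderiv Φ j u b)

/-- `ν` is the unit normal at `Φ u` which is future directed, the zeroth coordinate vector
being future directed. -/
structure IsFutureUnitNormal (g : (Fin 4 → ℝ) → Matrix (Fin 4) (Fin 4) ℝ)
    (Φ : (Fin 3 → ℝ) → (Fin 4 → ℝ)) (u : Fin 3 → ℝ) (ν : Fin 4 → ℝ) : Prop where
  unit : ν ⬝ᵥ (g (Φ u)).mulVec ν = -1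
  normal : ∀ i, ν ⬝ᵥ (g (Φ u)).mulVec (pderiv Φ i u) = 0
  future : ν ⬝ᵥ (g (Φ u)).mulVec (Pi.single 0 1) < 0

/-- The hypersurface `Φ` is spacelike at the parameter `u`. -/
def SpacelikeAt (g : (Fin 4 → ℝ) → Matrix (Fin 4) (Fin 4) ℝ)
    (Φ : (Fin 3 → ℝ) → (Fin 4 → ℝ)) (u : Fin 3 → ℝ) : Prop :=
  (firstForm g Φ u).PosDef

/-- The mean curvature at `u`, a third of the trace of the second fundamental form with respect
to the future directed unit normal, equals `H`. -/
def HasMeanCurvatureAt (g : (Fin 4 → ℝ) → Matrix (Fin 4) (Fin 4) ℝ)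
    (Φ : (Fin 3 → ℝ) → (Fin 4 → ℝ)) (u : Fin 3 → ℝ) (H : ℝ) : Prop :=
  ∃ ν, IsFutureUnitNormal g Φ u ν ∧
    ((firstForm g Φ u)⁻¹ * secondForm g Φ ν u).trace / 3 = H

end LorentzChart

namespace ReissnerNordstrom

/-- The spherically symmetric hypersurface `(T(X), X, θ, φ)`, in the parameters `(X, θ, φ)`. -/
def graphMap (T : ℝ → ℝ) (u : Fin 3 → ℝ) : Fin 4 → ℝ := ![T (u 0), u 0, u 1, u 2]

/-- The curve of the points `(T(X), X)`, `X ∈ I`, in the `(T, X)`-plane. -/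
def graphOver (I : Set ℝ) (T : ℝ → ℝ) : Set (ℝ × ℝ) := (fun X => (T X, X)) '' I

/-- `T`, considered on the open interval `I`, solves the initial value problem
`T(X₀) = T₀`, `T'(X₀) = V` for spacelike, spherically symmetric hypersurfaces with constant mean
curvature `H` in the maximally extended Reissner-Nordström spacetime. -/
structure IsSSCMCSolution (M e : ℝ) (F : ℝ → ℝ) (H T₀ X₀ V : ℝ) (I : Set ℝ) (T : ℝ → ℝ) :
    Prop where
  isOpen : IsOpen I
  ordConnected : I.OrdConnected
  mem : X₀ ∈ I
  regular : ContDiffOn ℝ 2 T I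
  initial_value : T X₀ = T₀
  initial_slope : deriv T X₀ = V
  mem_diagram : graphOver I T ⊆ penroseDiagram M e F
  spacelike : ∀ u : Fin 3 → ℝ, u 0 ∈ I → u 1 ∈ Ioo 0 Real.pi →
    LorentzChart.SpacelikeAt (metric M e F) (graphMap T) u
  mean_curvature : ∀ u : Fin 3 → ℝ, u 0 ∈ I → u 1 ∈ Ioo 0 Real.pi →
    LorentzChart.HasMeanCurvatureAt (metric M e F) (graphMap T) u H

end ReissnerNordstrom

end

/-! Write `P = Ω²`. The future unit normal of a spherically symmetric spacelike graph is a multiple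
of `∂_T + T' ∂_X`, and the trace of the second fundamental form turns the mean curvature condition
into the scalar equation `T'' = (1 - T'²) (3 H Ω √(1 - T'²) - ∂_T log (Ω r²) - T' ∂_X log (Ω r²))`.
The angles drop out (`hasMeanCurvatureAt_sphericalMetric_iff`, `isSSCMCSolution_iff`).

The coefficients are smooth on the whole diagram, horizons included. In Kruskal coordinates `r` is a
smooth inverse function applied to a product of smooth null coordinates, and `Ω²` is a positive
smooth function of `r` times derivatives of these coordinates. Where patches around `r = r₊` and `r
= r₋` overlap, both descriptions give the same `r` and `Ω²` (`contDiffAt_radius_confFactor`).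
Horizons thus play no special role in the equation.

Picard-Lindelöf and gluing give a unique maximal solution. A limit point of its graph in the diagram
could fail to lie on the graph only if the slope tended to `±1` there. The factor `1 - T'²` prevents
this: the derivative of `log (1 - T'²)` is `-2 T'` times the second factor of the equation, which is
bounded wherever the coefficients are. So `1 - T'²` stays bounded below, the limit point lifts to a
point with admissible slope, and the solution continues through it
(`IsTrajectory.exists_mem_closure`, `mem_of_maximal`). -/

/-! ### Maximal solutions of second order equations. -/

namespace SecondOrderODE
open Filter Topology Metric

/-- The pair `(S, U)` satisfies `S' = U`, `U' = G (S, X, U)` on `J`, with values in `D`. -/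
def IsTrajectory (D : Set (ℝ × ℝ × ℝ)) (G : ℝ × ℝ × ℝ → ℝ) (J : Set ℝ) (S U : ℝ → ℝ) : Prop :=
  ∀ X ∈ J, (S X, X, U X) ∈ D ∧ HasDerivAt S (U X) X ∧ HasDerivAt U (G (S X, X, U X)) X

/-- The autonomous vector field of the equation. -/
def field (G : ℝ × ℝ × ℝ → ℝ) (q : ℝ × ℝ × ℝ) : ℝ × ℝ × ℝ := (q.2.2, 1, G q)

variable {D : Set (ℝ × ℝ × ℝ)} {G : ℝ × ℝ × ℝ → ℝ} {I J J₁ J₂ : Set ℝ}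
  {S S₁ S₂ U U₁ U₂ : ℝ → ℝ} {X₀ : ℝ}

lemma contDiffAt_field {n : WithTop ℕ∞} {q : ℝ × ℝ × ℝ} (hG : ContDiffAt ℝ n G q) :
    ContDiffAt ℝ n (field G) q := by
  unfold field
  fun_prop

lemma IsTrajectory.mono (h : IsTrajectory D G J₁ S U) (hJ : J₂ ⊆ J₁) : IsTrajectory D G J₂ S U :=
  fun X hX => h X (hJ hX)

lemma IsTrajectory.hasDerivAt_field (h : IsTrajectory D G J S U) {X : ℝ} (hX : X ∈ J) :
    HasDerivAt (fun X => (S X, X, U X)) (field G (S X, X, U X)) X :=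
  (h X hX).2.1.prodMk ((hasDerivAt_id X).prodMk (h X hX).2.2)

lemma IsTrajectory.continuousOn (h : IsTrajectory D G J S U) :
    ContinuousOn (fun X => (S X, X, U X)) J :=
  fun _ hX => (h.hasDerivAt_field hX).continuousAt.continuousWithinAt

lemma IsTrajectory.congr (h : IsTrajectory D G J S U) (hJ : IsOpen J)
    (hS : EqOn S₁ S J) (hU : EqOn U₁ U J) : IsTrajectory D G J S₁ U₁ := by
  intro X hX
  have hn : J ∈ 𝓝 X := hJ.mem_nhds hX
  rw [hS hX, hU hX]
  exact ⟨(h X hX).1, (h X hX).2.1.congr_of_eventuallyEq (hS.eventuallyEq_of_mem hn),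
    (h X hX).2.2.congr_of_eventuallyEq (hU.eventuallyEq_of_mem hn)⟩

/-- A connectedness argument. Coincidence of germs is an open condition. It is also closed in `J`:
equality of values passes to limits by continuity, and the local Lipschitz uniqueness theorem
upgrades it to equality of germs. -/
lemma IsTrajectory.eqOn (hD : IsOpen D) (hG : ContDiffOn ℝ 1 G D)
    (h₁ : IsTrajectory D G J S₁ U₁) (h₂ : IsTrajectory D G J S₂ U₂) (hJ : IsOpen J)
    (hJc : J.OrdConnected) (hX₀ : X₀ ∈ J) (hS : S₁ X₀ = S₂ X₀) (hU : U₁ X₀ = U₂ X₀) :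
    EqOn S₁ S₂ J ∧ EqOn U₁ U₂ J := by
  set γ₁ : ℝ → ℝ × ℝ × ℝ := fun X => (S₁ X, X, U₁ X) with hγ₁
  set γ₂ : ℝ → ℝ × ℝ × ℝ := fun X => (S₂ X, X, U₂ X) with hγ₂
  have loc : ∀ X ∈ J, γ₁ X = γ₂ X → γ₁ =ᶠ[𝓝 X] γ₂ := by
    intro X hX he
    have hmem := (h₁ X hX).1
    have hf : ContDiffAt ℝ 1 (field G) (γ₁ X) :=
      contDiffAt_field (hG.contDiffAt (hD.mem_nhds hmem))
    obtain ⟨K, s, hs, hl⟩ := hf.exists_lipschitzOnWith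
    have hc₁ := (h₁.hasDerivAt_field hX).continuousAt
    have hc₂ : ContinuousAt γ₂ X := (h₂.hasDerivAt_field hX).continuousAt
    refine ODE_solution_unique_of_eventually (v := fun _ => field G) (s := fun _ => s) (K := K)
      (Eventually.of_forall fun _ => hl) ?_ ?_ he
    · filter_upwards [hJ.mem_nhds hX, hc₁ hs] with Y hY hYs
      exact ⟨h₁.hasDerivAt_field hY, hYs⟩
    · rw [he] at hs
      filter_upwards [hJ.mem_nhds hX, hc₂ hs] with Y hY hYs
      exact ⟨h₂.hasDerivAt_field hY, hYs⟩
  have key : J ⊆ {X | X ∈ J ∧ γ₁ =ᶠ[𝓝 X] γ₂} := by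
    refine hJc.isPreconnected.subset_of_closure_inter_subset ?_ ?_ ?_
    · exact hJ.inter isOpen_setOfPred_eventually_nhds
    · exact ⟨X₀, hX₀, hX₀, loc X₀ hX₀ (by simp [hγ₁, hγ₂, hS, hU])⟩
    · rintro X ⟨hXc, hX⟩
      refine ⟨hX, loc X hX ?_⟩
      have hfr : ∃ᶠ Y in 𝓝 X, γ₁ Y = γ₂ Y :=
        (mem_closure_iff_frequently.1 hXc).mono fun Y hY => hY.2.self_of_nhds
      by_contra hne
      have hc₁ : ContinuousAt γ₁ X := (h₁.hasDerivAt_field hX).continuousAt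
      have hc₂ : ContinuousAt γ₂ X := (h₂.hasDerivAt_field hX).continuousAt
      exact hfr (((hc₁.sub hc₂).eventually_ne (sub_ne_zero.2 hne)).mono
        fun Y hY h => hY (sub_eq_zero.2 h))
  have heq : ∀ X ∈ J, γ₁ X = γ₂ X := fun X hX => (key hX).2.self_of_nhds
  exact ⟨fun X hX => congrArg Prod.fst (heq X hX), fun X hX => congrArg (fun q => q.2.2) (heq X hX)⟩

/-- Local existence, on an interval of uniform length for all initial values near `q`. -/
lemma exists_isTrajectory_nhds (hD : IsOpen D) (hG : ContDiffOn ℝ 1 G D) {q : ℝ × ℝ × ℝ}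
    (hq : q ∈ D) : ∃ ε > (0 : ℝ), ∀ᶠ p in 𝓝 q, ∃ S U : ℝ → ℝ, S p.2.1 = p.1 ∧ U p.2.1 = p.2.2 ∧
      IsTrajectory D G (Ioo (p.2.1 - ε) (p.2.1 + ε)) S U := by
  have hf : ContDiffAt ℝ 1 (field G) q := contDiffAt_field (hG.contDiffAt (hD.mem_nhds hq))
  obtain ⟨δ, hδ, a, r, L, K, hr, hpl⟩ := IsPicardLindelof.of_contDiffAt_one hf
  obtain ⟨α, hα, hαc⟩ := (hpl 0).exists_forall_mem_closedBall_eq_hasDerivWithinAt_continuousOn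
  have hr' : (0 : ℝ) < r := hr
  have hq0 : α (q, 0) = q := (hα q (mem_closedBall_self hr'.le)).1
  have hcont : ContinuousAt α (q, 0) := by
    refine hαc.continuousAt (prod_mem_nhds (closedBall_mem_nhds q hr') ?_)
    exact Icc_mem_nhds (by simpa using hδ) (by simpa using hδ)
  -- Joint continuity of the flow in initial value and time gives one time span during which all
  -- flow lines starting near `q` stay in `D`.
  have hDn : ∀ᶠ z in 𝓝 (q, (0 : ℝ)), α z ∈ D :=
    hcont (by rw [hq0]; exact hD.mem_nhds hq)
  rw [nhds_prod_eq, Filter.eventually_prod_iff] at hDn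
  obtain ⟨pa, hpa, pb, hpb, hab⟩ := hDn
  obtain ⟨ε₁, hε₁, hball⟩ := Metric.eventually_nhds_iff_ball.1 hpb
  refine ⟨min δ ε₁, lt_min hδ hε₁, ?_⟩
  filter_upwards [hpa, closedBall_mem_nhds q hr'] with p hp hpr
  obtain ⟨hp0, hder⟩ := hα p hpr
  have hd : ∀ t ∈ Ioo (-(min δ ε₁)) (min δ ε₁),
      HasDerivAt (fun t => α (p, t)) (field G (α (p, t))) t := by
    intro t ht
    have h1 : -δ < t := (neg_le_neg (min_le_left _ _)).trans_lt ht.1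
    have h2 : t < δ := ht.2.trans_le (min_le_left _ _)
    exact (hder t ⟨by simpa using h1.le, by simpa using h2.le⟩).hasDerivAt
      (Icc_mem_nhds (by simpa using h1) (by simpa using h2))
  have hmem : ∀ t ∈ Ioo (-(min δ ε₁)) (min δ ε₁), α (p, t) ∈ D := by
    intro t ht
    refine hab hp (hball t ?_)
    rw [mem_ball_zero_iff, Real.norm_eq_abs, abs_lt]
    exact ⟨(neg_le_neg (min_le_right _ _)).trans_lt ht.1, ht.2.trans_le (min_le_right _ _)⟩
  have hzero : (0 : ℝ) ∈ Ioo (-(min δ ε₁)) (min δ ε₁) := by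
    have := lt_min hδ hε₁
    exact ⟨by linarith, this⟩
  -- The middle component of the field is `1`, so flow time is `X` up to a shift; this turns a flow
  -- line into a pair of functions of `X`.
  have hx : ∀ t ∈ Ioo (-(min δ ε₁)) (min δ ε₁), (α (p, t)).2.1 = p.2.1 + t := by
    have hdx : ∀ t ∈ Ioo (-(min δ ε₁)) (min δ ε₁),
        HasDerivAt (fun t => (α (p, t)).2.1 - t) 0 t := by
      intro t ht
      have h2 : HasDerivAt (fun t => (α (p, t)).2.1) 1 t := ((hd t ht).snd).fst
      have h3 := h2.fun_sub (hasDerivAt_id' t)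
      rwa [sub_self] at h3
    intro t ht
    have h4 := isOpen_Ioo.is_const_of_deriv_eq_zero isPreconnected_Ioo
      (fun t ht => (hdx t ht).differentiableAt.differentiableWithinAt)
      (fun t ht => (hdx t ht).deriv) ht hzero
    simp only [hp0, sub_zero] at h4
    linarith
  refine ⟨fun X => (α (p, X - p.2.1)).1, fun X => (α (p, X - p.2.1)).2.2, by simp [hp0],
    by simp [hp0], fun X hX => ?_⟩
  have ht : X - p.2.1 ∈ Ioo (-(min δ ε₁)) (min δ ε₁) := ⟨by linarith [hX.1], by linarith [hX.2]⟩
  have hpt : ((α (p, X - p.2.1)).1, X, (α (p, X - p.2.1)).2.2) = α (p, X - p.2.1) := by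
    have := hx _ ht
    refine Prod.ext rfl (Prod.ext ?_ rfl)
    simp only [this]; ring
  have h5 : HasDerivAt (fun X => α (p, X - p.2.1)) (field G (α (p, X - p.2.1))) X := by
    simpa using (hd _ ht).comp_sub_const X p.2.1
  refine ⟨by simpa only [hpt] using hmem _ ht, h5.fst, ?_⟩
  simp only [hpt]
  exact h5.snd.snd

/-- A trajectory on an open interval around `X₀` through `q` (with `q.2.1 = X₀`). -/
structure IsTrajectoryFrom (D : Set (ℝ × ℝ × ℝ)) (G : ℝ × ℝ × ℝ → ℝ) (T₀ X₀ V : ℝ) (J : Set ℝ)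
    (S U : ℝ → ℝ) : Prop where
  isOpen : IsOpen J
  ordConnected : J.OrdConnected
  mem : X₀ ∈ J
  value : S X₀ = T₀
  slope : U X₀ = V
  isTrajectory : IsTrajectory D G J S U

variable {T₀ V : ℝ}

lemma IsTrajectoryFrom.eqOn (hD : IsOpen D) (hG : ContDiffOn ℝ 1 G D)
    (h₁ : IsTrajectoryFrom D G T₀ X₀ V J₁ S₁ U₁) (h₂ : IsTrajectoryFrom D G T₀ X₀ V J₂ S₂ U₂) :
    EqOn S₁ S₂ (J₁ ∩ J₂) ∧ EqOn U₁ U₂ (J₁ ∩ J₂) :=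
  (h₁.isTrajectory.mono inter_subset_left).eqOn hD hG (h₂.isTrajectory.mono inter_subset_right)
    (h₁.isOpen.inter h₂.isOpen) (h₁.ordConnected.inter h₂.ordConnected) ⟨h₁.mem, h₂.mem⟩
    (h₁.value.trans h₂.value.symm) (h₁.slope.trans h₂.slope.symm)

/-- The maximal trajectory. -/
theorem exists_maximal (hD : IsOpen D) (hG : ContDiffOn ℝ 1 G D) (hq : (T₀, X₀, V) ∈ D) :
    ∃ I S U, IsTrajectoryFrom D G T₀ X₀ V I S U ∧
      ∀ J S' U', IsTrajectoryFrom D G T₀ X₀ V J S' U' → J ⊆ I ∧ EqOn S' S J ∧ EqOn U' U J := by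
  classical
  set I : Set ℝ := {X | ∃ J S U, IsTrajectoryFrom D G T₀ X₀ V J S U ∧ X ∈ J} with hI
  -- At each `X` the maximal solution takes the value at `X` of some trajectory reaching `X`; by
  -- uniqueness the choice does not matter.
  choose! J S U hJ hXJ using fun X (hX : X ∈ I) => hX
  have hsub : ∀ J' S' U', IsTrajectoryFrom D G T₀ X₀ V J' S' U' → J' ⊆ I :=
    fun J' S' U' h X hX => ⟨J', S', U', h, hX⟩
  have heq : ∀ J' S' U', IsTrajectoryFrom D G T₀ X₀ V J' S' U' →
      EqOn S' (fun X => S X X) J' ∧ EqOn U' (fun X => U X X) J' := by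
    intro J' S' U' h
    refine ⟨fun X hX => ?_, fun X hX => ?_⟩
    · exact (h.eqOn hD hG (hJ X (hsub _ _ _ h hX))).1 ⟨hX, hXJ X (hsub _ _ _ h hX)⟩
    · exact (h.eqOn hD hG (hJ X (hsub _ _ _ h hX))).2 ⟨hX, hXJ X (hsub _ _ _ h hX)⟩
  have hX₀ : X₀ ∈ I := by
    obtain ⟨ε, hε, h⟩ := exists_isTrajectory_nhds hD hG hq
    obtain ⟨S', U', hS', hU', h'⟩ := h.self_of_nhds
    have hm : X₀ ∈ Ioo (X₀ - ε) (X₀ + ε) := ⟨by linarith, by linarith⟩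
    exact ⟨_, S', U', ⟨isOpen_Ioo, ordConnected_Ioo, hm, hS', hU', h'⟩, hm⟩
  refine ⟨I, fun X => S X X, fun X => U X X, ⟨?_, ?_, hX₀, ?_, ?_, ?_⟩,
    fun J' S' U' h => ⟨hsub _ _ _ h, heq _ _ _ h⟩⟩
  · exact isOpen_iff_mem_nhds.2 fun X hX =>
      Filter.mem_of_superset ((hJ X hX).isOpen.mem_nhds (hXJ X hX)) (hsub _ _ _ (hJ X hX))
  · have hu : I = ⋃ X : I, J X := by
      ext X
      rw [mem_iUnion]
      exact ⟨fun hX => ⟨⟨X, hX⟩, hXJ X hX⟩, fun ⟨Y, hY⟩ => hsub _ _ _ (hJ Y Y.2) hY⟩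
    rw [hu]
    refine (isPreconnected_iUnion ⟨X₀, mem_iInter.2 fun Y : I => (hJ Y Y.2).mem⟩
      fun Y : I => (hJ Y Y.2).ordConnected.isPreconnected).ordConnected
  · exact (hJ X₀ hX₀).value
  · exact (hJ X₀ hX₀).slope
  · intro X hX
    exact ((hJ X hX).isTrajectory.congr (hJ X hX).isOpen (heq _ _ _ (hJ X hX)).1.symm
      (heq _ _ _ (hJ X hX)).2.symm) X (hXJ X hX)

/-- The graph of the maximal trajectory has no limit point in `D` beyond its interval. -/
lemma mem_of_maximal (hD : IsOpen D) (hG : ContDiffOn ℝ 1 G D)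
    (h : IsTrajectoryFrom D G T₀ X₀ V I S U)
    (hmax : ∀ J S' U', IsTrajectoryFrom D G T₀ X₀ V J S' U' → J ⊆ I)
    {q : ℝ × ℝ × ℝ} (hq : q ∈ D) (hcl : q ∈ closure ((fun X => (S X, X, U X)) '' I)) :
    q.2.1 ∈ I := by
  classical
  obtain ⟨ε, hε, hloc⟩ := exists_isTrajectory_nhds hD hG hq
  have hnear : ∀ᶠ p in 𝓝 q, |p.2.1 - q.2.1| < ε := by
    have hc : ContinuousAt (fun p : ℝ × ℝ × ℝ => |p.2.1 - q.2.1|) q := by fun_prop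
    exact hc (Iio_mem_nhds (by simpa using hε))
  -- Since `ε` is uniform near `q`, a point of the trajectory close enough to `q` launches a local
  -- solution whose interval reaches beyond `q.2.1`.
  obtain ⟨_, ⟨hp, hpε⟩, X₁, hX₁, rfl⟩ :=
    mem_closure_iff_nhds.1 hcl _ (Filter.inter_mem hloc hnear)
  obtain ⟨S₁, U₁, hS₁, hU₁, h₁⟩ := hp
  simp only [mem_ofPred_eq] at hS₁ hU₁ h₁ hpε
  set J := Ioo (X₁ - ε) (X₁ + ε) with hJdef
  have hX₁J : X₁ ∈ J := ⟨by linarith, by linarith⟩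
  have hqJ : q.2.1 ∈ J := by
    rw [abs_lt] at hpε
    exact ⟨by linarith, by linarith⟩
  obtain ⟨heS, heU⟩ := (h.isTrajectory.mono inter_subset_left).eqOn hD hG
    (h₁.mono inter_subset_right) (h.isOpen.inter isOpen_Ioo)
    (h.ordConnected.inter ordConnected_Ioo) ⟨hX₁, hX₁J⟩ hS₁.symm hU₁.symm
  -- On `I ∩ J` both solutions agree, having the same data at `X₁`, so the glued functions coincide
  -- with the local solution on all of `J`.
  have hpS : EqOn (I.piecewise S S₁) S₁ J := fun X hX => by
    by_cases hXI : X ∈ I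
    · simp only [hXI, piecewise_eq_of_mem]; exact heS ⟨hXI, hX⟩
    · simp [hXI]
  have hpU : EqOn (I.piecewise U U₁) U₁ J := fun X hX => by
    by_cases hXI : X ∈ I
    · simp only [hXI, piecewise_eq_of_mem]; exact heU ⟨hXI, hX⟩
    · simp [hXI]
  refine hmax (I ∪ J) (I.piecewise S S₁) (I.piecewise U U₁) ⟨h.isOpen.union isOpen_Ioo, ?_,
    Or.inl h.mem, by simp [h.mem, h.value], by simp [h.mem, h.slope], ?_⟩ (Or.inr hqJ)
  · exact (IsPreconnected.union X₁ hX₁ hX₁J h.ordConnected.isPreconnected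
      isPreconnected_Ioo).ordConnected
  · rintro X (hX | hX)
    · exact h.isTrajectory.congr h.isOpen (fun Y hY => by simp [hY]) (fun Y hY => by simp [hY]) X hX
    · exact h₁.congr isOpen_Ioo hpS hpU X hX

end SecondOrderODE

/-! ### The slope equation and the bound keeping its solutions spacelike. -/

namespace SecondOrderODE
open Filter Topology Metric

variable {D : Set (ℝ × ℝ × ℝ)} {G : ℝ × ℝ × ℝ → ℝ} {I J : Set ℝ}
  {S U T : ℝ → ℝ} {T₀ X₀ V : ℝ}

/-- Bootstrapping: if `S` and `U` are `C^n`, then so are their derivatives `U` and `G (S, X, U)`. -/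
lemma IsTrajectory.contDiffOn (h : IsTrajectory D G J S U) (hJ : IsOpen J)
    (hG : ContDiffOn ℝ ∞ G D) : ContDiffOn ℝ ∞ S J := by
  have hS : EqOn (deriv S) U J := fun X hX => (h X hX).2.1.deriv
  have hU : EqOn (deriv U) (fun X => G (S X, X, U X)) J := fun X hX => (h X hX).2.2.deriv
  have hSd : DifferentiableOn ℝ S J :=
    fun X hX => (h X hX).2.1.differentiableAt.differentiableWithinAt
  have hUd : DifferentiableOn ℝ U J :=
    fun X hX => (h X hX).2.2.differentiableAt.differentiableWithinAt
  have key : ∀ n : ℕ, ContDiffOn ℝ n S J ∧ ContDiffOn ℝ n U J := by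
    intro n
    induction n with
    | zero => exact ⟨contDiffOn_zero.2 hSd.continuousOn, contDiffOn_zero.2 hUd.continuousOn⟩
    | succ n ih =>
      have hq : ContDiffOn ℝ n (fun X => (S X, X, U X)) J :=
        ih.1.prodMk (contDiffOn_id.prodMk ih.2)
      have hGn : ContDiffOn ℝ n G D := hG.of_le (by exact_mod_cast le_top)
      -- The derivative criterion below has an extra clause for analytic regularity, void for finite
      -- `n`.
      have hw : ((n : WithTop ℕ∞) = ω) → False := by simp
      push_cast
      constructor
      · rw [contDiffOn_succ_iff_deriv_of_isOpen hJ]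
        exact ⟨hSd, fun h => (hw h).elim, ih.2.congr hS⟩
      · rw [contDiffOn_succ_iff_deriv_of_isOpen hJ]
        exact ⟨hUd, fun h => (hw h).elim, (hGn.comp hq fun X hX => (h X hX).1).congr hU⟩
  exact contDiffOn_infty.2 fun n => (key n).1

/-- The right-hand side of `S'' = (1 - S'²) (A √(1 - S'²) + B + C S')`, where `A`, `B`, `C` are
functions of `(S, X)`. -/
noncomputable def slopeRHS (A B C : ℝ × ℝ → ℝ) (q : ℝ × ℝ × ℝ) : ℝ :=
  (1 - q.2.2 ^ 2) *
    (A (q.1, q.2.1) * √(1 - q.2.2 ^ 2) + B (q.1, q.2.1) + C (q.1, q.2.1) * q.2.2)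

/-- Points of `Q` together with a slope of absolute value less than `1`. -/
def spacelikeSlopes (Q : Set (ℝ × ℝ)) : Set (ℝ × ℝ × ℝ) :=
  {q | (q.1, q.2.1) ∈ Q ∧ q.2.2 ^ 2 < 1}

/-- `S` is a `C²` solution on the open interval `J` of
`S'' = (1 - S'²) (A √(1 - S'²) + B + C S')` with graph in `Q` and `|S'| < 1`. -/
structure IsSlopeSolution (Q : Set (ℝ × ℝ)) (A B C : ℝ × ℝ → ℝ) (T₀ X₀ V : ℝ) (J : Set ℝ)
    (S : ℝ → ℝ) : Prop where
  isOpen : IsOpen J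
  ordConnected : J.OrdConnected
  mem : X₀ ∈ J
  regular : ContDiffOn ℝ 2 S J
  value : S X₀ = T₀
  slope : deriv S X₀ = V
  mem_domain : ∀ X ∈ J, (S X, X) ∈ Q
  slope_lt : ∀ X ∈ J, deriv S X ^ 2 < 1
  equation : ∀ X ∈ J, deriv (deriv S) X = slopeRHS A B C (S X, X, deriv S X)

variable {Q : Set (ℝ × ℝ)} {A B C : ℝ × ℝ → ℝ}

lemma isOpen_spacelikeSlopes (hQ : IsOpen Q) : IsOpen (spacelikeSlopes Q) :=
  (hQ.preimage (by fun_prop : Continuous fun q : ℝ × ℝ × ℝ => (q.1, q.2.1))).inter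
    (isOpen_lt (f := fun q : ℝ × ℝ × ℝ => q.2.2 ^ 2) (by fun_prop) continuous_const)

lemma contDiffOn_slopeRHS (hA : ContDiffOn ℝ ∞ A Q) (hB : ContDiffOn ℝ ∞ B Q)
    (hC : ContDiffOn ℝ ∞ C Q) : ContDiffOn ℝ ∞ (slopeRHS A B C) (spacelikeSlopes Q) := by
  have hp : ContDiffOn ℝ ∞ (fun q : ℝ × ℝ × ℝ => (q.1, q.2.1)) (spacelikeSlopes Q) := by fun_prop
  have hm : MapsTo (fun q : ℝ × ℝ × ℝ => (q.1, q.2.1)) (spacelikeSlopes Q) Q := fun q hq => hq.1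
  have hu : ContDiffOn ℝ ∞ (fun q : ℝ × ℝ × ℝ => q.2.2) (spacelikeSlopes Q) := by fun_prop
  have h1 : ContDiffOn ℝ ∞ (fun q : ℝ × ℝ × ℝ => 1 - q.2.2 ^ 2) (spacelikeSlopes Q) := by fun_prop
  have hs : ContDiffOn ℝ ∞ (fun q : ℝ × ℝ × ℝ => √(1 - q.2.2 ^ 2)) (spacelikeSlopes Q) :=
    h1.sqrt fun q hq => (sub_pos.2 hq.2).ne'
  exact h1.mul ((((hA.comp hp hm).mul hs).add (hB.comp hp hm)).add ((hC.comp hp hm).mul hu))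

lemma IsSlopeSolution.isTrajectoryFrom (h : IsSlopeSolution Q A B C T₀ X₀ V J S) :
    IsTrajectoryFrom (spacelikeSlopes Q) (slopeRHS A B C) T₀ X₀ V J S (deriv S) := by
  refine ⟨h.isOpen, h.ordConnected, h.mem, h.value, h.slope, fun X hX => ?_⟩
  have h2 : ContDiffOn ℝ (1 + 1) S J := by simpa [one_add_one_eq_two] using h.regular
  have h3 := ((contDiffOn_succ_iff_deriv_of_isOpen h.isOpen).1 h2).2.2
  refine ⟨⟨h.mem_domain X hX, h.slope_lt X hX⟩, ?_, ?_⟩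
  · exact ((h.regular.differentiableOn (by norm_num)).differentiableAt
      (h.isOpen.mem_nhds hX)).hasDerivAt
  · rw [← h.equation X hX]
    exact ((h3.differentiableOn (by norm_num)).differentiableAt (h.isOpen.mem_nhds hX)).hasDerivAt

lemma IsTrajectoryFrom.isSlopeSolution
    (h : IsTrajectoryFrom (spacelikeSlopes Q) (slopeRHS A B C) T₀ X₀ V J S U)
    (hG : ContDiffOn ℝ ∞ (slopeRHS A B C) (spacelikeSlopes Q)) :
    IsSlopeSolution Q A B C T₀ X₀ V J S := by
  have hd : EqOn (deriv S) U J := fun X hX => (h.isTrajectory X hX).2.1.deriv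
  refine ⟨h.isOpen, h.ordConnected, h.mem,
    (h.isTrajectory.contDiffOn h.isOpen hG).of_le (by norm_cast), h.value,
    (hd h.mem).trans h.slope, fun X hX => (h.isTrajectory X hX).1.1, fun X hX => ?_, fun X hX => ?_⟩
  · rw [hd hX]; exact (h.isTrajectory X hX).1.2
  · rw [hd hX, (hd.eventuallyEq_of_mem (h.isOpen.mem_nhds hX)).deriv_eq]
    exact (h.isTrajectory X hX).2.2.deriv

/-- Near a limit point in `Q` of the graph, the slope stays away from `±1`. -/
lemma IsTrajectory.exists_mem_closure (h : IsTrajectory (spacelikeSlopes Q) (slopeRHS A B C) I S U)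
    (hI : I.OrdConnected) (hQ : IsOpen Q) (hA : ContinuousOn A Q) (hB : ContinuousOn B Q)
    (hC : ContinuousOn C Q) {p : ℝ × ℝ} (hp : p ∈ Q)
    (hcl : p ∈ closure ((fun X => (S X, X)) '' I)) :
    ∃ u : ℝ, u ^ 2 < 1 ∧ (p.1, p.2, u) ∈ closure ((fun X => (S X, X, U X)) '' I) := by
  have hbd : ∃ K : ℝ, ∀ᶠ z in 𝓝 p, |A z| + |B z| + |C z| < K := by
    have hn := hQ.mem_nhds hp
    have hc : ContinuousAt (fun z => |A z| + |B z| + |C z|) p :=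
      ((hA.continuousAt hn).abs.add (hB.continuousAt hn).abs).add (hC.continuousAt hn).abs
    exact ⟨_, hc (Iio_mem_nhds (lt_add_one _))⟩
  obtain ⟨K, hK⟩ := hbd
  obtain ⟨ρ, hρ, hball⟩ := Metric.eventually_nhds_iff_ball.1 hK
  -- With `X₁` and all `X ∈ N` within `ρ / 4` of `p.2`, the variation of `S` over `N` is below `ρ /
  -- 2` because slopes are at most `1`. The graph over `N` therefore stays in the ball of radius `ρ`
  -- where the coefficients are bounded by `K`.
  obtain ⟨_, hX₁p, X₁, hX₁, rfl⟩ :=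
    mem_closure_iff_nhds.1 hcl _ (ball_mem_nhds p (by positivity : 0 < ρ / 4))
  set N : Set ℝ := I ∩ ball p.2 (ρ / 4) with hN
  have hNc : Convex ℝ N := hI.convex.inter (convex_ball _ _)
  rw [mem_ball, Prod.dist_eq, max_lt_iff, Real.dist_eq, Real.dist_eq] at hX₁p
  simp only at hX₁p
  have hX₁N : X₁ ∈ N := ⟨hX₁, by rw [mem_ball, Real.dist_eq]; exact hX₁p.2⟩
  have hd₁ : ∀ X ∈ N, |X - X₁| < ρ / 2 := by
    intro X hX
    have h1 := hX.2
    rw [mem_ball, Real.dist_eq] at h1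
    have := abs_sub_le X p.2 X₁
    rw [abs_sub_comm p.2 X₁] at this
    linarith [hX₁p.2]
  have hlip : ∀ X ∈ N, |S X - S X₁| ≤ |X - X₁| := by
    intro X hX
    have := hNc.norm_image_sub_le_of_norm_hasDerivWithin_le (f := S) (f' := U) (C := 1)
      (fun Y hY => (h Y hY.1).2.1.hasDerivWithinAt)
      (fun Y hY => by
        rw [Real.norm_eq_abs, ← sq_le_one_iff_abs_le_one]
        exact (h Y hY.1).1.2.le) hX₁N hX
    simpa using this
  have hNb : ∀ X ∈ N, (S X, X) ∈ ball p ρ := by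
    intro X hX
    have h1 := hd₁ X hX
    have h2 := hlip X hX
    have h3 := abs_sub_le (S X) (S X₁) p.1
    have h4 := hX.2
    rw [mem_ball, Real.dist_eq] at h4
    rw [mem_ball, Prod.dist_eq, max_lt_iff, Real.dist_eq, Real.dist_eq]
    exact ⟨by simp only; linarith [hX₁p.1], by simp only; linarith⟩
  have hK0 : 0 < K := lt_of_le_of_lt (by positivity) (hball p (mem_ball_self hρ))
  have hpos : ∀ X ∈ N, 0 < 1 - U X ^ 2 := fun X hX => sub_pos.2 (h X hX.1).1.2
  -- The factor `1 - U²` of the equation cancels in the logarithmic derivative, leaving a quantity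
  -- bounded by `2 K` however close the slope is to `±1`.
  have hlog : ∀ X ∈ N, |Real.log (1 - U X ^ 2) - Real.log (1 - U X₁ ^ 2)| ≤ 2 * K * |X - X₁| := by
    intro X hX
    have := hNc.norm_image_sub_le_of_norm_hasDerivWithin_le
      (f := fun Y => Real.log (1 - U Y ^ 2))
      (f' := fun Y => -2 * U Y * (A (S Y, Y) * √(1 - U Y ^ 2) + B (S Y, Y) + C (S Y, Y) * U Y))
      (C := 2 * K) (fun Y hY => ?_) (fun Y hY => ?_) hX₁N hX
    · simpa using this
    · have h1 := (((h Y hY.1).2.2.pow 2).const_sub 1).log (hpos Y hY).ne'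
      refine (h1.congr_deriv ?_).hasDerivWithinAt
      have := (hpos Y hY).ne'
      simp only [slopeRHS, Pi.pow_apply]
      field_simp
      push_cast
      ring
    · have hu : |U Y| ≤ 1 := by
        rw [← sq_le_one_iff_abs_le_one]; exact (h Y hY.1).1.2.le
      have hs : |√(1 - U Y ^ 2)| ≤ 1 := by
        rw [abs_of_nonneg (Real.sqrt_nonneg _)]
        exact Real.sqrt_le_one.2 (by linarith [sq_nonneg (U Y)])
      have hb := hball _ (hNb Y hY)
      rw [Real.norm_eq_abs, abs_mul, abs_mul, abs_neg, abs_two]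
      have h3 : |A (S Y, Y) * √(1 - U Y ^ 2) + B (S Y, Y) + C (S Y, Y) * U Y| ≤ K := by
        refine (abs_add_three _ _ _).trans ?_
        rw [abs_mul, abs_mul]
        have h4 := mul_le_mul_of_nonneg_left hs (abs_nonneg (A (S Y, Y)))
        have h5 := mul_le_mul_of_nonneg_left hu (abs_nonneg (C (S Y, Y)))
        linarith
      calc 2 * |U Y| * _ ≤ 2 * 1 * K := by gcongr
        _ = 2 * K := by ring
  -- The logarithm changes by at most `2 K · ρ / 2` over `N`.
  set δ : ℝ := Real.exp (Real.log (1 - U X₁ ^ 2) - K * ρ) with hδ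
  have hδN : ∀ X ∈ N, δ ≤ 1 - U X ^ 2 := by
    intro X hX
    rw [← Real.exp_log (hpos X hX), hδ, Real.exp_le_exp]
    have h1 := (abs_le.1 (hlog X hX)).1
    have h2 : 2 * K * |X - X₁| ≤ K * ρ := by
      have := mul_le_mul_of_nonneg_left (hd₁ X hX).le hK0.le
      linarith
    linarith
  have hpN : p ∈ closure ((fun X => (S X, X)) '' N) := by
    rw [mem_closure_iff_nhds]
    intro W hW
    obtain ⟨_, ⟨hzW, hz⟩, X, hX, rfl⟩ := mem_closure_iff_nhds.1 hcl _
      (Filter.inter_mem hW (continuous_snd.continuousAt (ball_mem_nhds p.2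
        (by positivity : 0 < ρ / 4))))
    exact ⟨_, hzW, X, ⟨hX, hz⟩, rfl⟩
  set E : Set (ℝ × ℝ × ℝ) := (fun X => (S X, X, U X)) '' N with hE
  have hEsub : E ⊆ {q | δ ≤ 1 - q.2.2 ^ 2} := by
    rintro _ ⟨X, hX, rfl⟩
    exact hδN X hX
  have hEb : Bornology.IsBounded E := by
    have hb : Bornology.IsBounded ((ball p.1 ρ) ×ˢ ((ball p.2 ρ) ×ˢ (Icc (-1 : ℝ) 1))) :=
      isBounded_ball.prod (isBounded_ball.prod (isBounded_Icc _ _))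
    refine hb.subset ?_
    rintro _ ⟨X, hX, rfl⟩
    have h1 := hNb X hX
    rw [← ball_prod_same] at h1
    exact ⟨h1.1, h1.2, abs_le.1 (sq_le_one_iff_abs_le_one _ |>.1 (h X hX.1).1.2.le)⟩
  -- Compactness supplies a limit slope: the closure of the bounded set `E` projects onto a closed
  -- set containing the graph over `N`, hence containing `p`.
  have hproj : p ∈ (fun q : ℝ × ℝ × ℝ => (q.1, q.2.1)) '' closure E := by
    have hc : IsClosed ((fun q : ℝ × ℝ × ℝ => (q.1, q.2.1)) '' closure E) :=
      (hEb.isCompact_closure.image (by fun_prop)).isClosed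
    refine closure_minimal ?_ hc hpN
    rintro _ ⟨X, hX, rfl⟩
    exact ⟨_, subset_closure ⟨X, hX, rfl⟩, rfl⟩
  obtain ⟨q, hq, hqp⟩ := hproj
  have hqδ : δ ≤ 1 - q.2.2 ^ 2 :=
    closure_minimal hEsub (isClosed_le continuous_const (by fun_prop)) hq
  refine ⟨q.2.2, by linarith [Real.exp_pos (Real.log (1 - U X₁ ^ 2) - K * ρ)], ?_⟩
  rw [← hqp]
  exact closure_mono (image_mono inter_subset_left) hq

theorem exists_maximal_isSlopeSolution (hQ : IsOpen Q) (hA : ContDiffOn ℝ ∞ A Q)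
    (hB : ContDiffOn ℝ ∞ B Q) (hC : ContDiffOn ℝ ∞ C Q) (hp : (T₀, X₀) ∈ Q) (hV : V ^ 2 < 1) :
    ∃ (I : Set ℝ) (T : ℝ → ℝ), IsSlopeSolution Q A B C T₀ X₀ V I T ∧ ContDiffOn ℝ ∞ T I ∧
      (∀ p ∈ Q, p ∈ closure ((fun X => (T X, X)) '' I) → p ∈ (fun X => (T X, X)) '' I) ∧
      ∀ J S, IsSlopeSolution Q A B C T₀ X₀ V J S → J ⊆ I ∧ EqOn S T J := by
  have hD := isOpen_spacelikeSlopes hQ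
  have hG := contDiffOn_slopeRHS hA hB hC
  have hG₁ : ContDiffOn ℝ 1 (slopeRHS A B C) (spacelikeSlopes Q) :=
    hG.of_le (by exact_mod_cast le_top)
  have hq : (T₀, X₀, V) ∈ spacelikeSlopes Q := ⟨hp, hV⟩
  obtain ⟨I, T, U, h, hmax⟩ := exists_maximal hD hG₁ hq
  refine ⟨I, T, h.isSlopeSolution hG, h.isTrajectory.contDiffOn h.isOpen hG, ?_, fun J S hS => ?_⟩
  · intro p hpQ hcl
    obtain ⟨u, hu, hucl⟩ := h.isTrajectory.exists_mem_closure h.ordConnected hQ hA.continuousOn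
      hB.continuousOn hC.continuousOn hpQ hcl
    have hpI : p.2 ∈ I :=
      mem_of_maximal hD hG₁ h (fun J S' U' h' => (hmax J S' U' h').1) (q := (p.1, p.2, u))
        ⟨hpQ, hu⟩ hucl
    refine ⟨p.2, hpI, Prod.ext ?_ rfl⟩
    -- Once its abscissa lies in `I`, a limit point is on the graph: by continuity of `T` at `p.2`,
    -- a nonzero `T p.2 - p.1` would remain nonzero at graph points near `p`.
    have hc : ContinuousAt T p.2 := (h.isTrajectory _ hpI).2.1.continuousAt
    by_contra hne
    have hc2 : ContinuousAt (fun z : ℝ × ℝ => T z.2 - z.1) p :=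
      (ContinuousAt.comp (g := T) hc continuousAt_snd).sub continuousAt_fst
    obtain ⟨_, hz, X, hX, rfl⟩ := mem_closure_iff_nhds.1 hcl _
      (hc2.eventually_ne (sub_ne_zero.2 hne))
    exact hz (sub_self _)
  · have := hmax J S _ hS.isTrajectoryFrom
    exact ⟨this.1, this.2.1⟩

end SecondOrderODE

/-! ### The mean curvature of spherically symmetric graphs. -/

namespace LorentzChart
open Filter Topology Matrix

/-- The spherically symmetric metric `P (-dT² + dX²) + R² (dθ² + sin²θ dφ²)` for functions `P`, `R`
of `(T, X)`. -/
noncomputable def sphericalMetric (P R : ℝ × ℝ → ℝ) (y : Fin 4 → ℝ) : Matrix (Fin 4) (Fin 4) ℝ :=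
  Matrix.diagonal ![-P (y 0, y 1), P (y 0, y 1), R (y 0, y 1) ^ 2,
    R (y 0, y 1) ^ 2 * Real.sin (y 2) ^ 2]

variable {P R f : ℝ × ℝ → ℝ} {T : ℝ → ℝ} {y : Fin 4 → ℝ} {u : Fin 3 → ℝ}

lemma _root_.HasFDerivAt.pderiv {n : ℕ} {E : Type*} [NormedAddCommGroup E] [NormedSpace ℝ E]
    {f : (Fin n → ℝ) → E} {f' : (Fin n → ℝ) →L[ℝ] E} {v : Fin n → ℝ} (h : HasFDerivAt f f' v)
    (i : Fin n) : pderiv f i v = f' (Pi.single i 1) := by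
  rw [LorentzChart.pderiv, h.fderiv]

lemma pderiv_const {n : ℕ} {E : Type*} [NormedAddCommGroup E] [NormedSpace ℝ E] (c : E)
    (i : Fin n) (v : Fin n → ℝ) : pderiv (fun _ => c) i v = 0 := by
  simp [pderiv]

lemma pderiv_congr {n : ℕ} {E : Type*} [NormedAddCommGroup E] [NormedSpace ℝ E]
    {f g : (Fin n → ℝ) → E} {v : Fin n → ℝ} (h : f =ᶠ[𝓝 v] g) (i : Fin n) :
    pderiv f i v = pderiv g i v := by
  rw [pderiv, pderiv, h.fderiv_eq]

lemma hasFDerivAt_comp_coords (hf : DifferentiableAt ℝ f (y 0, y 1)) :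
    HasFDerivAt (fun z : Fin 4 → ℝ => f (z 0, z 1))
      ((fderiv ℝ f (y 0, y 1)).comp
        ((ContinuousLinearMap.proj (R := ℝ) (φ := fun _ : Fin 4 => ℝ) 0).prod
          (ContinuousLinearMap.proj 1))) y :=
  HasFDerivAt.comp (f := fun z : Fin 4 → ℝ => (z 0, z 1)) y hf.hasFDerivAt
    ((hasFDerivAt_apply 0 y).prodMk (hasFDerivAt_apply 1 y))

lemma pderiv_comp_coords_zero (hf : DifferentiableAt ℝ f (y 0, y 1)) :
    pderiv (fun z : Fin 4 → ℝ => f (z 0, z 1)) 0 y = fderiv ℝ f (y 0, y 1) (1, 0) := by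
  rw [(hasFDerivAt_comp_coords hf).pderiv]
  simp

lemma pderiv_comp_coords_one (hf : DifferentiableAt ℝ f (y 0, y 1)) :
    pderiv (fun z : Fin 4 → ℝ => f (z 0, z 1)) 1 y = fderiv ℝ f (y 0, y 1) (0, 1) := by
  rw [(hasFDerivAt_comp_coords hf).pderiv]
  simp

lemma pderiv_neg {n : ℕ} (f : (Fin n → ℝ) → ℝ) (i : Fin n) (v : Fin n → ℝ) :
    pderiv (fun z => -f z) i v = -pderiv f i v := by
  simp [pderiv, fderiv_fun_neg]

lemma pderiv_coords_sq (hf : DifferentiableAt ℝ f (y 0, y 1)) (i : Fin 4) :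
    pderiv (fun z : Fin 4 → ℝ => f (z 0, z 1) ^ 2) i y
      = 2 * f (y 0, y 1) * pderiv (fun z : Fin 4 → ℝ => f (z 0, z 1)) i y := by
  have h := hasFDerivAt_comp_coords hf
  rw [(h.pow 2).pderiv, h.pderiv]
  simp

lemma pderiv_coords_sq_mul_sin_sq (hf : DifferentiableAt ℝ f (y 0, y 1)) {i : Fin 4} (hi : i ≠ 2) :
    pderiv (fun z : Fin 4 → ℝ => f (z 0, z 1) ^ 2 * Real.sin (z 2) ^ 2) i y
      = 2 * f (y 0, y 1) * pderiv (fun z : Fin 4 → ℝ => f (z 0, z 1)) i y * Real.sin (y 2) ^ 2 := by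
  have h := hasFDerivAt_comp_coords hf
  have h2 := ((hasFDerivAt_apply (𝕜 := ℝ) (2 : Fin 4) y).sin).pow 2
  have h3 := HasFDerivAt.fun_mul (h.pow 2) h2
  rw [h3.pderiv, h.pderiv]
  simp [hi]
  ring

lemma hasFDerivAt_graphMap (hT : DifferentiableAt ℝ T (u 0)) :
    HasFDerivAt (ReissnerNordstrom.graphMap T)
      (ContinuousLinearMap.pi ![deriv T (u 0) • ContinuousLinearMap.proj 0,
        ContinuousLinearMap.proj (R := ℝ) (φ := fun _ : Fin 3 => ℝ) 0,
        ContinuousLinearMap.proj 1, ContinuousLinearMap.proj 2]) u := by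
  rw [hasFDerivAt_pi']
  intro i
  have h0 : HasFDerivAt (fun z : Fin 3 → ℝ => T (z 0)) (deriv T (u 0) •
      ContinuousLinearMap.proj (0 : Fin 3)) u :=
    HasDerivAt.comp_hasFDerivAt (f := fun z : Fin 3 → ℝ => z 0) u hT.hasDerivAt
      (hasFDerivAt_apply (𝕜 := ℝ) (0 : Fin 3) u)
  fin_cases i
  · exact h0
  · exact hasFDerivAt_apply 0 u
  · exact hasFDerivAt_apply 1 u
  · exact hasFDerivAt_apply 2 u

lemma pderiv_graphMap_zero (hT : DifferentiableAt ℝ T (u 0)) :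
    pderiv (ReissnerNordstrom.graphMap T) 0 u = ![deriv T (u 0), 1, 0, 0] := by
  rw [(hasFDerivAt_graphMap hT).pderiv]
  ext i
  fin_cases i <;> simp

lemma pderiv_graphMap_one (hT : DifferentiableAt ℝ T (u 0)) :
    pderiv (ReissnerNordstrom.graphMap T) 1 u = ![0, 0, 1, 0] := by
  rw [(hasFDerivAt_graphMap hT).pderiv]
  ext i
  fin_cases i <;> simp

lemma pderiv_graphMap_two (hT : DifferentiableAt ℝ T (u 0)) :
    pderiv (ReissnerNordstrom.graphMap T) 2 u = ![0, 0, 0, 1] := by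
  rw [(hasFDerivAt_graphMap hT).pderiv]
  ext i
  fin_cases i <;> simp

lemma eventually_comp_apply_zero {p : ℝ → Prop} (h : ∀ᶠ X in 𝓝 (u 0), p X) : ∀ᶠ z in 𝓝 u, p (z 0) :=
  ((continuous_apply 0).tendsto u).eventually h

lemma pderiv_pderiv_graphMap_zero (hT : ∀ᶠ X in 𝓝 (u 0), DifferentiableAt ℝ T X)
    (hT' : DifferentiableAt ℝ (deriv T) (u 0)) :
    pderiv (fun z => pderiv (ReissnerNordstrom.graphMap T) 0 z) 0 u
      = ![deriv (deriv T) (u 0), 0, 0, 0] := by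
  have h1 : (fun z => pderiv (ReissnerNordstrom.graphMap T) 0 z) =ᶠ[𝓝 u]
      fun z => ![deriv T (z 0), 1, 0, 0] :=
    (eventually_comp_apply_zero hT).mono fun z hz => pderiv_graphMap_zero hz
  rw [pderiv_congr h1]
  have h0 : HasFDerivAt (fun z : Fin 3 → ℝ => deriv T (z 0))
      (deriv (deriv T) (u 0) •
      ContinuousLinearMap.proj (0 : Fin 3)) u :=
    HasDerivAt.comp_hasFDerivAt (f := fun z : Fin 3 → ℝ => z 0) u hT'.hasDerivAt
      (hasFDerivAt_apply (𝕜 := ℝ) (0 : Fin 3) u)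
  have h2 : HasFDerivAt (fun z : Fin 3 → ℝ => ![deriv T (z 0), 1, 0, 0])
      (ContinuousLinearMap.pi ![deriv (deriv T) (u 0) •
        ContinuousLinearMap.proj (R := ℝ) (φ := fun _ : Fin 3 => ℝ) 0, 0, 0, 0]) u := by
    rw [hasFDerivAt_pi']
    intro i
    fin_cases i
    · exact h0
    · exact hasFDerivAt_const (1 : ℝ) u
    · exact hasFDerivAt_const (0 : ℝ) u
    · exact hasFDerivAt_const (0 : ℝ) u
  rw [h2.pderiv]
  ext i
  fin_cases i <;> simp

lemma pderiv_pderiv_graphMap_one (hT : ∀ᶠ X in 𝓝 (u 0), DifferentiableAt ℝ T X) (i : Fin 3) :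
    pderiv (fun z => pderiv (ReissnerNordstrom.graphMap T) 1 z) i u = 0 := by
  have h1 : (fun z => pderiv (ReissnerNordstrom.graphMap T) 1 z) =ᶠ[𝓝 u] fun z => ![0, 0, 1, 0] :=
    (eventually_comp_apply_zero hT).mono fun z hz => pderiv_graphMap_one hz
  rw [pderiv_congr h1, pderiv_const]

lemma pderiv_pderiv_graphMap_two (hT : ∀ᶠ X in 𝓝 (u 0), DifferentiableAt ℝ T X) (i : Fin 3) :
    pderiv (fun z => pderiv (ReissnerNordstrom.graphMap T) 2 z) i u = 0 := by
  have h1 : (fun z => pderiv (ReissnerNordstrom.graphMap T) 2 z) =ᶠ[𝓝 u] fun z => ![0, 0, 0, 1] :=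
    (eventually_comp_apply_zero hT).mono fun z hz => pderiv_graphMap_two hz
  rw [pderiv_congr h1, pderiv_const]

lemma firstForm_sphericalMetric (hT : DifferentiableAt ℝ T (u 0)) :
    firstForm (sphericalMetric P R) (ReissnerNordstrom.graphMap T) u =
      Matrix.diagonal ![P (T (u 0), u 0) * (1 - deriv T (u 0) ^ 2), R (T (u 0), u 0) ^ 2,
        R (T (u 0), u 0) ^ 2 * Real.sin (u 1) ^ 2] := by
  ext i j
  fin_cases i <;> fin_cases j <;>
    simp [firstForm, sphericalMetric, pderiv_graphMap_zero hT, pderiv_graphMap_one hT,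
      pderiv_graphMap_two hT, ReissnerNordstrom.graphMap, Matrix.mulVec_diagonal, dotProduct,
      Fin.sum_univ_four]
  ring

theorem spacelikeAt_sphericalMetric_iff (hT : DifferentiableAt ℝ T (u 0))
    (hP : 0 < P (T (u 0), u 0)) (hR : 0 < R (T (u 0), u 0)) (hu : 0 < Real.sin (u 1)) :
    SpacelikeAt (sphericalMetric P R) (ReissnerNordstrom.graphMap T) u ↔
      deriv T (u 0) ^ 2 < 1 := by
  rw [SpacelikeAt, firstForm_sphericalMetric hT, Matrix.posDef_diagonal_iff]
  constructor
  · intro h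
    have h0 := h 0
    simp only [Matrix.cons_val_zero] at h0
    exact sub_pos.1 ((mul_pos_iff_of_pos_left hP).1 h0)
  · intro h i
    have := sub_pos.2 h
    fin_cases i <;> simp <;> positivity

/-- Christoffel symbols contracted with a normal vector tangent to the `(T, X)`-plane. -/
lemma sum_christoffel (g : (Fin 4 → ℝ) → Matrix (Fin 4) (Fin 4) ℝ) (y : Fin 4 → ℝ) (n m : ℝ)
    (a b : Fin 4 → ℝ) :
    ∑ l, ∑ i, ∑ j, christoffel g y l i j * (![n, m, 0, 0] : Fin 4 → ℝ) l * a i * b j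
      = n * ∑ i, ∑ j, christoffel g y 0 i j * a i * b j
        + m * ∑ i, ∑ j, christoffel g y 1 i j * a i * b j := by
  rw [Fin.sum_univ_four]
  simp only [Matrix.cons_val_zero, Matrix.cons_val_one, Matrix.cons_val, mul_zero, zero_mul,
    Finset.sum_const_zero, add_zero, Finset.mul_sum]
  congr 1 <;> exact Finset.sum_congr rfl fun i _ => Finset.sum_congr rfl fun j _ => by ring

/-- The `(T, X)`-part of the metric is conformally flat, so `(1, T')` is orthogonal to the tangent
`(T', 1)`. The scale `n` of the normal is left free and fixed later by normalisation. -/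
lemma secondForm_sphericalMetric_zero (hP : DifferentiableAt ℝ P (T (u 0), u 0))
    (hT : ∀ᶠ X in 𝓝 (u 0), DifferentiableAt ℝ T X)
    (hT' : DifferentiableAt ℝ (deriv T) (u 0)) (n : ℝ) :
    secondForm (sphericalMetric P R) (ReissnerNordstrom.graphMap T)
      ![n, n * deriv T (u 0), 0, 0] u 0 0 =
      n * (P (T (u 0), u 0) * deriv (deriv T) (u 0) + (1 - deriv T (u 0) ^ 2) / 2 *
        (fderiv ℝ P (T (u 0), u 0) (1, 0) + deriv T (u 0) * fderiv ℝ P (T (u 0), u 0) (0, 1))) := by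
  set y := ReissnerNordstrom.graphMap T u with hy
  have hP' : DifferentiableAt ℝ P (y 0, y 1) := hP
  have p0 : pderiv (fun z : Fin 4 → ℝ => P (z 0, z 1)) 0 y = fderiv ℝ P (T (u 0), u 0) (1, 0) :=
    pderiv_comp_coords_zero hP'
  have p1 : pderiv (fun z : Fin 4 → ℝ => P (z 0, z 1)) 1 y = fderiv ℝ P (T (u 0), u 0) (0, 1) :=
    pderiv_comp_coords_one hP'
  rw [secondForm, Matrix.of_apply, sum_christoffel, pderiv_pderiv_graphMap_zero hT hT',
    pderiv_graphMap_zero hT.self_of_nhds, ← hy]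
  have hy0 : y 0 = T (u 0) := rfl
  have hy1 : y 1 = u 0 := rfl
  simp [Fin.sum_univ_four, christoffel, sphericalMetric, Matrix.mulVec_diagonal, dotProduct,
    pderiv_const, pderiv_neg, p0, p1, hy0, hy1]
  ring

/-- In the angular directions the second fundamental form is half the normal derivative of the
metric, here half the derivative of `R²` along `ν`. -/
lemma secondForm_sphericalMetric_one (hR : DifferentiableAt ℝ R (T (u 0), u 0))
    (hT : ∀ᶠ X in 𝓝 (u 0), DifferentiableAt ℝ T X) (n : ℝ) :
    secondForm (sphericalMetric P R) (ReissnerNordstrom.graphMap T)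
      ![n, n * deriv T (u 0), 0, 0] u 1 1 =
      n * R (T (u 0), u 0) * (fderiv ℝ R (T (u 0), u 0) (1, 0)
        + deriv T (u 0) * fderiv ℝ R (T (u 0), u 0) (0, 1)) := by
  set y := ReissnerNordstrom.graphMap T u with hy
  have hR' : DifferentiableAt ℝ R (y 0, y 1) := hR
  have p0 : pderiv (fun z : Fin 4 → ℝ => R (z 0, z 1)) 0 y = fderiv ℝ R (T (u 0), u 0) (1, 0) :=
    pderiv_comp_coords_zero hR'
  have p1 : pderiv (fun z : Fin 4 → ℝ => R (z 0, z 1)) 1 y = fderiv ℝ R (T (u 0), u 0) (0, 1) :=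
    pderiv_comp_coords_one hR'
  rw [secondForm, Matrix.of_apply, sum_christoffel, pderiv_pderiv_graphMap_one hT,
    pderiv_graphMap_one hT.self_of_nhds, ← hy]
  have hy0 : y 0 = T (u 0) := rfl
  have hy1 : y 1 = u 0 := rfl
  simp [Fin.sum_univ_four, christoffel, sphericalMetric,
    pderiv_const, pderiv_coords_sq hR', p0, p1, hy0, hy1]
  ring

lemma secondForm_sphericalMetric_two (hR : DifferentiableAt ℝ R (T (u 0), u 0))
    (hT : ∀ᶠ X in 𝓝 (u 0), DifferentiableAt ℝ T X) (n : ℝ) :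
    secondForm (sphericalMetric P R) (ReissnerNordstrom.graphMap T)
      ![n, n * deriv T (u 0), 0, 0] u 2 2 =
      n * R (T (u 0), u 0) * (fderiv ℝ R (T (u 0), u 0) (1, 0)
        + deriv T (u 0) * fderiv ℝ R (T (u 0), u 0) (0, 1)) * Real.sin (u 1) ^ 2 := by
  set y := ReissnerNordstrom.graphMap T u with hy
  have hR' : DifferentiableAt ℝ R (y 0, y 1) := hR
  have p0 : pderiv (fun z : Fin 4 → ℝ => R (z 0, z 1)) 0 y = fderiv ℝ R (T (u 0), u 0) (1, 0) :=
    pderiv_comp_coords_zero hR'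
  have p1 : pderiv (fun z : Fin 4 → ℝ => R (z 0, z 1)) 1 y = fderiv ℝ R (T (u 0), u 0) (0, 1) :=
    pderiv_comp_coords_one hR'
  rw [secondForm, Matrix.of_apply, sum_christoffel, pderiv_pderiv_graphMap_two hT,
    pderiv_graphMap_two hT.self_of_nhds, ← hy]
  have hy0 : y 0 = T (u 0) := rfl
  have hy1 : y 1 = u 0 := rfl
  have hy2 : y 2 = u 1 := rfl
  simp [Fin.sum_univ_four, christoffel, sphericalMetric,
    pderiv_const, pderiv_coords_sq_mul_sin_sq hR', p0, p1, hy0, hy1, hy2]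
  ring

/-- Orthogonality to the spheres removes the angular components, orthogonality to the curve fixes
the direction in the `(T, X)`-plane, the norm fixes the length and the time orientation the sign. -/
lemma isFutureUnitNormal_sphericalMetric_iff (hT : DifferentiableAt ℝ T (u 0))
    (hP : 0 < P (T (u 0), u 0)) (hR : 0 < R (T (u 0), u 0)) (hu : 0 < Real.sin (u 1))
    (hT1 : deriv T (u 0) ^ 2 < 1) (ν : Fin 4 → ℝ) :
    IsFutureUnitNormal (sphericalMetric P R) (ReissnerNordstrom.graphMap T) u ν ↔
      ν = ![(√(P (T (u 0), u 0)) * √(1 - deriv T (u 0) ^ 2))⁻¹,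
        (√(P (T (u 0), u 0)) * √(1 - deriv T (u 0) ^ 2))⁻¹ * deriv T (u 0), 0, 0] := by
  have h1 := sub_pos.2 hT1
  set N := √(P (T (u 0), u 0)) * √(1 - deriv T (u 0) ^ 2) with hN
  have hNpos : 0 < N := by positivity
  have hN2 : N ^ 2 = P (T (u 0), u 0) * (1 - deriv T (u 0) ^ 2) := by
    rw [hN, mul_pow, Real.sq_sqrt hP.le, Real.sq_sqrt h1.le]
  constructor
  · rintro ⟨hunit, hnorm, hfut⟩
    have n0 := hnorm 0
    have n1 := hnorm 1
    have n2 := hnorm 2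
    rw [pderiv_graphMap_zero hT] at n0
    rw [pderiv_graphMap_one hT] at n1
    rw [pderiv_graphMap_two hT] at n2
    simp [sphericalMetric, Matrix.mulVec_diagonal, dotProduct, Fin.sum_univ_four,
      ReissnerNordstrom.graphMap] at hunit hfut n0 n1 n2
    have e2 : ν 2 = 0 := n1.resolve_right hR.ne'
    have e3 : ν 3 = 0 := n2.resolve_right (not_or.2 ⟨hR.ne', hu.ne'⟩)
    have e1 : ν 1 = ν 0 * deriv T (u 0) := by
      have : P (T (u 0), u 0) * (ν 1 - ν 0 * deriv T (u 0)) = 0 := by linarith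
      linarith [(mul_eq_zero.1 this).resolve_left hP.ne']
    have e0 : 0 < ν 0 := by
      by_contra hc
      nlinarith
    have e0' : ν 0 = N⁻¹ := by
      rw [e1, e2, e3] at hunit
      have : (ν 0 * N) ^ 2 = 1 := by rw [mul_pow, hN2]; linarith
      have : ν 0 * N = 1 := (pow_eq_one_iff_of_nonneg (by positivity) two_ne_zero).1 this
      exact eq_inv_of_mul_eq_one_left this
    ext i
    fin_cases i <;> simp [e1, e2, e3, e0']
  · rintro rfl
    refine ⟨?_, fun i => ?_, ?_⟩
    · simp [sphericalMetric, Matrix.mulVec_diagonal, dotProduct, Fin.sum_univ_four,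
        ReissnerNordstrom.graphMap]
      field_simp
      linarith
    · fin_cases i <;>
      simp [sphericalMetric, Matrix.mulVec_diagonal, dotProduct, Fin.sum_univ_four,
        ReissnerNordstrom.graphMap, pderiv_graphMap_zero hT, pderiv_graphMap_one hT,
        pderiv_graphMap_two hT]
      ring
    · simp [sphericalMetric, Matrix.mulVec_diagonal, dotProduct, Fin.sum_univ_four,
        ReissnerNordstrom.graphMap]
      positivity

/-- The mean curvature equation of a spherically symmetric spacelike graph. -/
theorem hasMeanCurvatureAt_sphericalMetric_iff
    (hPd : DifferentiableAt ℝ P (T (u 0), u 0)) (hRd : DifferentiableAt ℝ R (T (u 0), u 0))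
    (hT : ∀ᶠ X in 𝓝 (u 0), DifferentiableAt ℝ T X) (hT' : DifferentiableAt ℝ (deriv T) (u 0))
    (hP : 0 < P (T (u 0), u 0)) (hR : 0 < R (T (u 0), u 0)) (hu : 0 < Real.sin (u 1))
    (hT1 : deriv T (u 0) ^ 2 < 1) (H : ℝ) :
    HasMeanCurvatureAt (sphericalMetric P R) (ReissnerNordstrom.graphMap T) u H ↔
      deriv (deriv T) (u 0) = SecondOrderODE.slopeRHS (fun z => 3 * H * √(P z))
        (fun z => -(fderiv ℝ P z (1, 0) / (2 * P z) + 2 * fderiv ℝ R z (1, 0) / R z))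
        (fun z => -(fderiv ℝ P z (0, 1) / (2 * P z) + 2 * fderiv ℝ R z (0, 1) / R z))
        (T (u 0), u 0, deriv T (u 0)) := by
  have hTu := hT.self_of_nhds
  have hinv : (firstForm (sphericalMetric P R) (ReissnerNordstrom.graphMap T) u)⁻¹ =
      Matrix.diagonal ![(P (T (u 0), u 0) * (1 - deriv T (u 0) ^ 2))⁻¹, (R (T (u 0), u 0) ^ 2)⁻¹,
        (R (T (u 0), u 0) ^ 2 * Real.sin (u 1) ^ 2)⁻¹] := by
    refine Matrix.inv_eq_right_inv ?_
    rw [firstForm_sphericalMetric hTu, Matrix.diagonal_mul_diagonal, ← Matrix.diagonal_one]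
    congr 1
    have := (sub_pos.2 hT1).ne'
    ext i
    fin_cases i
    · simp only [Fin.zero_eta, Matrix.cons_val_zero, mul_inv_cancel₀ (mul_ne_zero hP.ne' this)]
    · simp [hR.ne']
    · have : R (T (u 0), u 0) ^ 2 * Real.sin (u 1) ^ 2 ≠ 0 := by positivity
      simpa using mul_inv_cancel₀ this
  rw [HasMeanCurvatureAt]
  simp only [isFutureUnitNormal_sphericalMetric_iff hTu hP hR hu hT1, exists_eq_left]
  rw [hinv, Matrix.trace_fin_three]
  simp only [Matrix.diagonal_mul, secondForm_sphericalMetric_zero hPd hT hT',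
    secondForm_sphericalMetric_one hRd hT, secondForm_sphericalMetric_two hRd hT,
    SecondOrderODE.slopeRHS, Matrix.cons_val_zero, Matrix.cons_val_one, Matrix.cons_val]
  have h1 := sub_pos.2 hT1
  set V := deriv T (u 0)
  set q := (T (u 0), u 0)
  -- In terms of `b` and `c`, with `P = b²` and `1 - V² = c²`, the equation contains no roots and is
  -- linear in the second derivative.
  set b := √(P q) with hb
  set c := √(1 - V ^ 2) with hc
  have hbpos : 0 < b := Real.sqrt_pos.2 hP
  have hcpos : 0 < c := Real.sqrt_pos.2 h1
  have hP2 : P q = b ^ 2 := (Real.sq_sqrt hP.le).symm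
  have hV2 : 1 - V ^ 2 = c ^ 2 := (Real.sq_sqrt h1.le).symm
  rw [hP2, hV2]
  have hs := hu.ne'
  field_simp
  constructor <;> intro h <;> linarith

end LorentzChart

/-! ### Radial functions of the two kinds of Kruskal patches. -/

namespace ReissnerNordstrom
open Filter Topology

variable {M e : ℝ} {F : ℝ → ℝ} {r v w : ℝ}

/-! ### Horizons -/

lemma rMinus_pos (hM : 0 < M) (he : 0 < e ^ 2) : 0 < rMinus M e := by
  rw [rMinus, sub_pos, Real.sqrt_lt' hM]
  linarith

lemma rMinus_lt_rPlus (heM : e ^ 2 < M ^ 2) : rMinus M e < rPlus M e := by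
  have := Real.sqrt_pos.2 (sub_pos.2 heM)
  rw [rMinus, rPlus]
  linarith

lemma rPlus_pos (hM : 0 < M) : 0 < rPlus M e :=
  add_pos_of_pos_of_nonneg hM (Real.sqrt_nonneg _)

lemma kPlus_pos (hM : 0 < M) (heM : e ^ 2 < M ^ 2) : 0 < kPlus M e :=
  div_pos (sub_pos.2 (rMinus_lt_rPlus heM)) (by have := rPlus_pos (e := e) hM; positivity)

lemma kMinus_pos (hM : 0 < M) (he : 0 < e ^ 2) (heM : e ^ 2 < M ^ 2) : 0 < kMinus M e :=
  div_pos (sub_pos.2 (rMinus_lt_rPlus heM)) (by have := rMinus_pos hM he; positivity)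

lemma kPlus_div_kMinus (hM : 0 < M) (he : 0 < e ^ 2) (heM : e ^ 2 < M ^ 2) :
    kPlus M e / kMinus M e = rMinus M e ^ 2 / rPlus M e ^ 2 := by
  have h1 := rMinus_pos hM he
  have h2 := rPlus_pos (e := e) hM
  have h3 := (sub_pos.2 (rMinus_lt_rPlus heM)).ne'
  rw [kPlus, kMinus]
  field_simp

lemma kMinus_div_kPlus (hM : 0 < M) (he : 0 < e ^ 2) (heM : e ^ 2 < M ^ 2) :
    kMinus M e / kPlus M e = rPlus M e ^ 2 / rMinus M e ^ 2 := by
  rw [← inv_div, kPlus_div_kMinus hM he heM, inv_div]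

/-! ### The radial functions -/

lemma quotPlus_pos (hM : 0 < M) (he : 0 < e ^ 2) (hr : rMinus M e < r) : 0 < quotPlus M e r := by
  have h1 := rMinus_pos hM he
  have h2 := rPlus_pos (e := e) hM
  have h3 : 0 < r := h1.trans hr
  have h4 : 0 < r / rMinus M e - 1 := sub_pos.2 ((one_lt_div h1).2 hr)
  unfold quotPlus
  positivity

lemma quotMinus_pos (hM : 0 < M) (he : 0 < e ^ 2) (hr0 : 0 < r) (hr : r < rPlus M e) :
    0 < quotMinus M e r := by
  have h1 := rMinus_pos hM he
  have h2 := rPlus_pos (e := e) hM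
  have h4 : 0 < 1 - r / rPlus M e := sub_pos.2 ((div_lt_one h2).2 hr)
  unfold quotMinus
  positivity

/-- Since `r*` is a primitive of `1/h`, the logarithmic derivative of `± exp (2 κ₊ r*)` is `2 κ₊ /
h`. Using `quotPlus` for the quotient of `h` by this function keeps the formula valid at `r₊`. -/
lemma hasDerivAt_radialPlus (hM : 0 < M) (he : 0 < e ^ 2) (heM : e ^ 2 < M ^ 2)
    (hr : rMinus M e < r) : HasDerivAt (radialPlus M e) (2 * kPlus M e / quotPlus M e r) r := by
  have h1 := rMinus_pos hM he
  have h2 := rPlus_pos (e := e) hM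
  have h3 : 0 < r := h1.trans hr
  have hlt := sub_pos.2 (rMinus_lt_rPlus heM)
  have h4 : 0 < r / rMinus M e - 1 := sub_pos.2 ((one_lt_div h1).2 hr)
  have d1 : HasDerivAt (fun r : ℝ => r / rPlus M e - 1) (1 / rPlus M e) r :=
    ((hasDerivAt_id' r).div_const _).sub_const _
  have d2 : HasDerivAt (fun r : ℝ => Real.exp (2 * kPlus M e * r))
      (Real.exp (2 * kPlus M e * r) * (2 * kPlus M e * 1)) r :=
    ((hasDerivAt_id' r).const_mul _).exp
  have d3 := ((((hasDerivAt_id' r).div_const (rMinus M e)).sub_const 1).rpow_const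
    (p := -(kPlus M e / kMinus M e)) (Or.inl h4.ne'))
  refine ((d1.mul d2).mul d3).congr_deriv ?_
  have e1 : Real.exp (-2 * kPlus M e * r) = (Real.exp (2 * kPlus M e * r))⁻¹ := by
    rw [← Real.exp_neg]; ring_nf
  simp only [Pi.mul_apply]
  rw [quotPlus, e1, Real.rpow_sub_one h4.ne', Real.rpow_one_add' h4.le
    (by rw [kPlus_div_kMinus hM he heM]; positivity), Real.rpow_neg h4.le,
    kPlus_div_kMinus hM he heM]
  have hE := Real.exp_pos (2 * kPlus M e * r)
  generalize Real.exp (2 * kPlus M e * r) = E at hE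
  have hA := Real.rpow_pos_of_pos h4 (rMinus M e ^ 2 / rPlus M e ^ 2)
  generalize (r / rMinus M e - 1) ^ (rMinus M e ^ 2 / rPlus M e ^ 2) = A at hA
  rw [kPlus]
  have h5 : r - rMinus M e ≠ 0 := (sub_pos.2 hr).ne'
  have h6 : r / rMinus M e - 1 = (r - rMinus M e) / rMinus M e := by field_simp
  rw [h6]
  field_simp
  ring

lemma hasDerivAt_radialMinus (hM : 0 < M) (he : 0 < e ^ 2) (heM : e ^ 2 < M ^ 2)
    (hr0 : 0 < r) (hr : r < rPlus M e) :
    HasDerivAt (radialMinus M e) (-(2 * kMinus M e / quotMinus M e r)) r := by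
  have h1 := rMinus_pos hM he
  have h2 := rPlus_pos (e := e) hM
  have h3 := hr0.ne'
  have hlt := sub_pos.2 (rMinus_lt_rPlus heM)
  have h4 : 0 < 1 - r / rPlus M e := sub_pos.2 ((div_lt_one h2).2 hr)
  have d1 : HasDerivAt (fun r : ℝ => 1 - r / rMinus M e) (-(1 / rMinus M e)) r :=
    ((hasDerivAt_id' r).div_const _).const_sub _
  have d2 : HasDerivAt (fun r : ℝ => Real.exp (-2 * kMinus M e * r))
      (Real.exp (-2 * kMinus M e * r) * (-2 * kMinus M e * 1)) r :=
    ((hasDerivAt_id' r).const_mul _).exp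
  have d3 := ((((hasDerivAt_id' r).div_const (rPlus M e)).const_sub 1).rpow_const
    (p := -(kMinus M e / kPlus M e)) (Or.inl h4.ne'))
  refine ((d1.mul d2).mul d3).congr_deriv ?_
  have e1 : Real.exp (-2 * kMinus M e * r) = (Real.exp (2 * kMinus M e * r))⁻¹ := by
    rw [← Real.exp_neg]; ring_nf
  simp only [Pi.mul_apply]
  rw [quotMinus, e1, Real.rpow_sub_one h4.ne', Real.rpow_one_add' h4.le
    (by rw [kMinus_div_kPlus hM he heM]; positivity), Real.rpow_neg h4.le,
    kMinus_div_kPlus hM he heM]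
  have hE := Real.exp_pos (2 * kMinus M e * r)
  generalize Real.exp (2 * kMinus M e * r) = E at hE
  have hA := Real.rpow_pos_of_pos h4 (rPlus M e ^ 2 / rMinus M e ^ 2)
  generalize (1 - r / rPlus M e) ^ (rPlus M e ^ 2 / rMinus M e ^ 2) = A at hA
  rw [kMinus]
  have h5 : rPlus M e - r ≠ 0 := (sub_pos.2 hr).ne'
  have h6 : 1 - r / rPlus M e = (rPlus M e - r) / rPlus M e := by field_simp
  rw [h6]
  field_simp
  ring

lemma contDiffAt_quotPlus (hM : 0 < M) (he : 0 < e ^ 2) (hr : rMinus M e < r) :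
    ContDiffAt ℝ ∞ (quotPlus M e) r := by
  have h1 := rMinus_pos hM he
  have h3 : 0 < r := h1.trans hr
  have h4 : 0 < r / rMinus M e - 1 := sub_pos.2 ((one_lt_div h1).2 hr)
  have c1 : ContDiffAt ℝ ∞ (fun r => rPlus M e * rMinus M e / r ^ 2) r :=
    contDiffAt_const.div (by fun_prop) (by positivity)
  have c2 : ContDiffAt ℝ ∞ (fun r => Real.exp (-2 * kPlus M e * r)) r := by fun_prop
  have c3 : ContDiffAt ℝ ∞ (fun r => r / rMinus M e - 1) r := by fun_prop
  exact (c1.mul c2).mul (c3.rpow_const_of_ne h4.ne')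

lemma contDiffAt_quotMinus (hM : 0 < M) (hr0 : 0 < r) (hr : r < rPlus M e) :
    ContDiffAt ℝ ∞ (quotMinus M e) r := by
  have h2 := rPlus_pos (e := e) hM
  have h4 : 0 < 1 - r / rPlus M e := sub_pos.2 ((div_lt_one h2).2 hr)
  have c1 : ContDiffAt ℝ ∞ (fun r => rPlus M e * rMinus M e / r ^ 2) r :=
    contDiffAt_const.div (by fun_prop) (by positivity)
  have c2 : ContDiffAt ℝ ∞ (fun r => Real.exp (2 * kMinus M e * r)) r := by fun_prop
  have c3 : ContDiffAt ℝ ∞ (fun r => 1 - r / rPlus M e) r := by fun_prop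
  exact (c1.mul c2).mul (c3.rpow_const_of_ne h4.ne')

lemma contDiffAt_radialPlus (hM : 0 < M) (he : 0 < e ^ 2) (hr : rMinus M e < r) :
    ContDiffAt ℝ ∞ (radialPlus M e) r := by
  have h1 := rMinus_pos hM he
  have h4 : 0 < r / rMinus M e - 1 := sub_pos.2 ((one_lt_div h1).2 hr)
  have c1 : ContDiffAt ℝ ∞ (fun r => r / rPlus M e - 1) r := by fun_prop
  have c2 : ContDiffAt ℝ ∞ (fun r => Real.exp (2 * kPlus M e * r)) r := by fun_prop
  have c3 : ContDiffAt ℝ ∞ (fun r => r / rMinus M e - 1) r := by fun_prop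
  exact (c1.mul c2).mul (c3.rpow_const_of_ne h4.ne')

lemma contDiffAt_radialMinus (hM : 0 < M) (hr : r < rPlus M e) :
    ContDiffAt ℝ ∞ (radialMinus M e) r := by
  have h2 := rPlus_pos (e := e) hM
  have h4 : 0 < 1 - r / rPlus M e := sub_pos.2 ((div_lt_one h2).2 hr)
  have c1 : ContDiffAt ℝ ∞ (fun r => 1 - r / rMinus M e) r := by fun_prop
  have c2 : ContDiffAt ℝ ∞ (fun r => Real.exp (-2 * kMinus M e * r)) r := by fun_prop
  have c3 : ContDiffAt ℝ ∞ (fun r => 1 - r / rPlus M e) r := by fun_prop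
  exact (c1.mul c2).mul (c3.rpow_const_of_ne h4.ne')

lemma injOn_radialPlus (hM : 0 < M) (he : 0 < e ^ 2) (heM : e ^ 2 < M ^ 2) :
    InjOn (radialPlus M e) (Ioi (rMinus M e)) := by
  refine (strictMonoOn_of_deriv_pos (convex_Ioi _)
    (fun r hr => (contDiffAt_radialPlus hM he hr).continuousAt.continuousWithinAt) ?_).injOn
  rw [interior_Ioi]
  intro r hr
  rw [(hasDerivAt_radialPlus hM he heM hr).deriv]
  have := quotPlus_pos hM he hr
  have := kPlus_pos hM heM
  positivity

lemma injOn_radialMinus (hM : 0 < M) (he : 0 < e ^ 2) (heM : e ^ 2 < M ^ 2) :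
    InjOn (radialMinus M e) (Ioo 0 (rPlus M e)) := by
  refine (strictAntiOn_of_deriv_neg (convex_Ioo _ _)
    (fun r hr => (contDiffAt_radialMinus hM hr.2).continuousAt.continuousWithinAt) ?_).injOn
  rw [interior_Ioo]
  intro r hr
  rw [(hasDerivAt_radialMinus hM he heM hr.1 hr.2).deriv, neg_lt_zero]
  have := quotMinus_pos hM he hr.1 hr.2
  have := kMinus_pos hM he heM
  positivity

/-- The negative power blows up at `r₋` against a negative factor, giving `-∞`; for large `r` the
exponential wins. The intermediate value theorem does the rest. -/
lemma surjOn_radialPlus (hM : 0 < M) (he : 0 < e ^ 2) (heM : e ^ 2 < M ^ 2) :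
    SurjOn (radialPlus M e) (Ioi (rMinus M e)) univ := by
  intro y _
  have h1 := rMinus_pos hM he
  have h2 := rPlus_pos (e := e) hM
  have hlt := rMinus_lt_rPlus heM
  have ha : 0 < kPlus M e / kMinus M e := div_pos (kPlus_pos hM heM) (kMinus_pos hM he heM)
  -- The ratio is `(r₋ / r₊)²`; that it is at most `1` allows the power to be bounded below by a
  -- plain inverse.
  have ha1 : kPlus M e / kMinus M e ≤ 1 := by
    rw [kPlus_div_kMinus hM he heM, div_le_one (by positivity)]
    exact pow_le_pow_left₀ h1.le hlt.le 2
  have hcont : ContinuousOn (radialPlus M e) (Ioi (rMinus M e)) := fun r hr =>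
    (contDiffAt_radialPlus hM he hr).continuousAt.continuousWithinAt
  have hlow : ∃ r ∈ Ioi (rMinus M e), radialPlus M e r ≤ y := by
    have t1 : Tendsto (fun r : ℝ => r / rMinus M e - 1) (𝓝[>] (rMinus M e)) (𝓝[>] 0) := by
      refine tendsto_nhdsWithin_iff.2 ⟨?_, ?_⟩
      · have : ContinuousAt (fun r : ℝ => r / rMinus M e - 1) (rMinus M e) := by fun_prop
        have h := this.tendsto.mono_left (nhdsWithin_le_nhds (s := Ioi (rMinus M e)))
        simpa [div_self h1.ne'] using h
      · filter_upwards [self_mem_nhdsWithin] with r hr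
        exact sub_pos.2 ((one_lt_div h1).2 hr)
    have t2 := (tendsto_rpow_neg_nhdsGT_zero (neg_lt_zero.2 ha)).comp t1
    have t3 : Tendsto (fun r : ℝ => (r / rPlus M e - 1) * Real.exp (2 * kPlus M e * r))
        (𝓝[>] (rMinus M e))
        (𝓝 ((rMinus M e / rPlus M e - 1) * Real.exp (2 * kPlus M e * rMinus M e))) := by
      have : ContinuousAt (fun r : ℝ => (r / rPlus M e - 1) * Real.exp (2 * kPlus M e * r))
        (rMinus M e) := by fun_prop
      exact this.tendsto.mono_left nhdsWithin_le_nhds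
    have hneg : (rMinus M e / rPlus M e - 1) * Real.exp (2 * kPlus M e * rMinus M e) < 0 :=
      mul_neg_of_neg_of_pos (sub_neg.2 ((div_lt_one h2).2 hlt)) (Real.exp_pos _)
    have t4 : Tendsto (radialPlus M e) (𝓝[>] (rMinus M e)) atBot := t3.neg_mul_atTop hneg t2
    obtain ⟨r, hr, hr'⟩ := ((t4.eventually_le_atBot y).and self_mem_nhdsWithin).exists
    exact ⟨r, hr', hr⟩
  have hhigh : ∃ r ∈ Ioi (rMinus M e), y ≤ radialPlus M e r := by
    have t1 : Tendsto (fun r : ℝ => Real.exp (2 * kPlus M e * r)) atTop atTop :=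
      Real.tendsto_exp_atTop.comp
        (tendsto_id.const_mul_atTop (mul_pos two_pos (kPlus_pos hM heM)))
    -- The constant is a lower bound for `(r / r₊ - 1) / (r / r₋ - 1)` when `r ≥ 2 r₊`, as then `r -
    -- r₋ ≤ 2 (r - r₊)`.
    have t2 : Tendsto (fun r : ℝ => Real.exp (2 * kPlus M e * r) * (rMinus M e / (2 * rPlus M e)))
        atTop atTop := t1.atTop_mul_const (by positivity)
    obtain ⟨r, hry, hr2⟩ := ((t2.eventually_ge_atTop y).and
      (eventually_ge_atTop (2 * rPlus M e))).exists
    have hrm : rMinus M e < r := by linarith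
    refine ⟨r, hrm, hry.trans ?_⟩
    have hz : 1 ≤ r / rMinus M e - 1 := by
      rw [le_sub_iff_add_le, le_div_iff₀ h1]; linarith
    have hzp : (r / rMinus M e - 1)⁻¹ ≤ (r / rMinus M e - 1) ^ (-(kPlus M e / kMinus M e)) := by
      rw [← Real.rpow_neg_one]
      exact Real.rpow_le_rpow_of_exponent_le hz (by linarith)
    have hq : rMinus M e / (2 * rPlus M e) ≤ (r / rPlus M e - 1) * (r / rMinus M e - 1)⁻¹ := by
      have h6 : r / rMinus M e - 1 = (r - rMinus M e) / rMinus M e := by field_simp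
      have h7 : r / rPlus M e - 1 = (r - rPlus M e) / rPlus M e := by field_simp
      have h8 : 0 < r - rMinus M e := by linarith
      rw [h6, h7, inv_div, div_mul_div_comm, div_le_div_iff₀ (by positivity) (by positivity)]
      have : 0 ≤ rMinus M e * rPlus M e * (r - 2 * rPlus M e + rMinus M e) := by
        have : 0 ≤ r - 2 * rPlus M e + rMinus M e := by linarith
        positivity
      nlinarith
    have h9 : 0 ≤ r / rPlus M e - 1 := by
      rw [sub_nonneg, le_div_iff₀ h2]; linarith
    calc Real.exp (2 * kPlus M e * r) * (rMinus M e / (2 * rPlus M e))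
        ≤ Real.exp (2 * kPlus M e * r) * ((r / rPlus M e - 1) * (r / rMinus M e - 1)⁻¹) := by gcongr
      _ ≤ Real.exp (2 * kPlus M e * r) *
          ((r / rPlus M e - 1) * (r / rMinus M e - 1) ^ (-(kPlus M e / kMinus M e))) := by gcongr
      _ = radialPlus M e r := by rw [radialPlus]; ring
  obtain ⟨a, ha, hay⟩ := hlow
  obtain ⟨b, hb, hby⟩ := hhigh
  exact isPreconnected_Ioi.intermediate_value ha hb hcont ⟨hay, hby⟩

lemma surjOn_radialMinus (hM : 0 < M) (he : 0 < e ^ 2) (heM : e ^ 2 < M ^ 2) :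
    SurjOn (radialMinus M e) (Ioo 0 (rPlus M e)) (Iio 1) := by
  intro y hy
  have h1 := rMinus_pos hM he
  have h2 := rPlus_pos (e := e) hM
  have hlt := rMinus_lt_rPlus heM
  have ha : 0 < kMinus M e / kPlus M e := div_pos (kMinus_pos hM he heM) (kPlus_pos hM heM)
  have hcont : ContinuousOn (radialMinus M e) (Ioo 0 (rPlus M e)) := fun r hr =>
    (contDiffAt_radialMinus hM hr.2).continuousAt.continuousWithinAt
  have hlow : ∃ r ∈ Ioo 0 (rPlus M e), radialMinus M e r ≤ y := by
    have t1 : Tendsto (fun r : ℝ => 1 - r / rPlus M e) (𝓝[<] (rPlus M e)) (𝓝[>] 0) := by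
      refine tendsto_nhdsWithin_iff.2 ⟨?_, ?_⟩
      · have : ContinuousAt (fun r : ℝ => 1 - r / rPlus M e) (rPlus M e) := by fun_prop
        have h := this.tendsto.mono_left (nhdsWithin_le_nhds (s := Iio (rPlus M e)))
        simpa [div_self h2.ne'] using h
      · filter_upwards [self_mem_nhdsWithin] with r hr
        exact sub_pos.2 ((div_lt_one h2).2 hr)
    have t2 := (tendsto_rpow_neg_nhdsGT_zero (neg_lt_zero.2 ha)).comp t1
    have t3 : Tendsto (fun r : ℝ => (1 - r / rMinus M e) * Real.exp (-2 * kMinus M e * r))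
        (𝓝[<] (rPlus M e))
        (𝓝 ((1 - rPlus M e / rMinus M e) * Real.exp (-2 * kMinus M e * rPlus M e))) := by
      have : ContinuousAt (fun r : ℝ => (1 - r / rMinus M e) * Real.exp (-2 * kMinus M e * r))
        (rPlus M e) := by fun_prop
      exact this.tendsto.mono_left nhdsWithin_le_nhds
    have hneg : (1 - rPlus M e / rMinus M e) * Real.exp (-2 * kMinus M e * rPlus M e) < 0 :=
      mul_neg_of_neg_of_pos (sub_neg.2 ((one_lt_div h1).2 hlt)) (Real.exp_pos _)
    have t4 : Tendsto (radialMinus M e) (𝓝[<] (rPlus M e)) atBot := t3.neg_mul_atTop hneg t2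
    obtain ⟨r, hr, hr'⟩ := ((t4.eventually_le_atBot y).and (Ioo_mem_nhdsLT h2)).exists
    exact ⟨r, hr', hr⟩
  have hhigh : ∃ r ∈ Ioo 0 (rPlus M e), y ≤ radialMinus M e r := by
    -- The radial function, unlike the metric, is regular at the singularity, where its value is the
    -- excluded bound `1`.
    have hc : ContinuousAt (radialMinus M e) 0 := (contDiffAt_radialMinus hM h2).continuousAt
    have h0 : radialMinus M e 0 = 1 := by simp [radialMinus]
    have hev : ∀ᶠ r in 𝓝[>] (0 : ℝ), y < radialMinus M e r :=
      nhdsWithin_le_nhds (hc (by rw [h0]; exact Ioi_mem_nhds hy))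
    obtain ⟨r, hr, hr'⟩ := (hev.and (Ioo_mem_nhdsGT h2)).exists
    exact ⟨r, hr', hr.le⟩
  obtain ⟨a, ha, hay⟩ := hlow
  obtain ⟨b, hb, hby⟩ := hhigh
  exact isPreconnected_Ioo.intermediate_value ha hb hcont ⟨hay, hby⟩

/-- Near `f x` the smooth local inverse takes values in `s`, so injectivity on `s` forces the
globally chosen inverse to agree with it. -/
lemma contDiffAt_invFunOn {f : ℝ → ℝ} {s : Set ℝ} {x : ℝ} {n : WithTop ℕ∞} (hs : IsOpen s)
    (hx : x ∈ s) (hinj : InjOn f s) (hf : ContDiffAt ℝ n f x) (hn : n ≠ 0) (hd : deriv f x ≠ 0) :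
    ContDiffAt ℝ n (Function.invFunOn f s) (f x) := by
  have hfd : HasDerivAt f (deriv f x) x := (hf.differentiableAt hn).hasDerivAt
  have hf' := hfd.hasFDerivAt_equiv hd
  refine (hf.to_localInverse hf' hn).congr_of_eventuallyEq ?_
  have hst := hf.hasStrictFDerivAt' hf' hn
  have e1 : ∀ᶠ y in 𝓝 (f x), f (hf.localInverse hf' hn y) = y := hst.eventually_right_inverse
  have e2 : ∀ᶠ y in 𝓝 (f x), hf.localInverse hf' hn y ∈ s :=
    hst.localInverse_tendsto (hs.mem_nhds hx)
  filter_upwards [e1, e2] with y h1 h2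
  have hex : ∃ a ∈ s, f a = y := ⟨_, h2, h1⟩
  exact hinj (Function.invFunOn_mem hex) h2 ((Function.invFunOn_eq hex).trans h1.symm)

/-- The right-hand side is `h` in factored form, `(r - r₊) (r - r₋) / r²`. The product for
`radialMinus` is the same, which is what matches the conformal factors of the two patches. -/
lemma radialPlus_mul_quotPlus (hM : 0 < M) (he : 0 < e ^ 2)
    (hr : rMinus M e < r) : radialPlus M e r * quotPlus M e r =
      rPlus M e * rMinus M e / r ^ 2 * (r / rPlus M e - 1) * (r / rMinus M e - 1) := by
  have h1 := rMinus_pos hM he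
  have h4 : 0 < r / rMinus M e - 1 := sub_pos.2 ((one_lt_div h1).2 hr)
  have e1 : Real.exp (-2 * kPlus M e * r) = (Real.exp (2 * kPlus M e * r))⁻¹ := by
    rw [← Real.exp_neg]; ring_nf
  have e2 : (r / rMinus M e - 1) ^ (-(kPlus M e / kMinus M e)) *
      (r / rMinus M e - 1) ^ (1 + kPlus M e / kMinus M e) = r / rMinus M e - 1 := by
    rw [← Real.rpow_add h4]; simp
  have hE := (Real.exp_pos (2 * kPlus M e * r)).ne'
  calc radialPlus M e r * quotPlus M e r
      = (r / rPlus M e - 1) * (Real.exp (-2 * kPlus M e * r) * Real.exp (2 * kPlus M e * r)) *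
        (rPlus M e * rMinus M e / r ^ 2) * ((r / rMinus M e - 1) ^ (-(kPlus M e / kMinus M e)) *
      (r / rMinus M e - 1) ^ (1 + kPlus M e / kMinus M e)) := by rw [radialPlus, quotPlus]; ring
    _ = _ := by rw [e2, e1, inv_mul_cancel₀ hE]; ring

lemma radialMinus_mul_quotMinus (hM : 0 < M) (hr : r < rPlus M e) :
    radialMinus M e r * quotMinus M e r =
      rPlus M e * rMinus M e / r ^ 2 * (r / rPlus M e - 1) * (r / rMinus M e - 1) := by
  have h2 := rPlus_pos (e := e) hM
  have h4 : 0 < 1 - r / rPlus M e := sub_pos.2 ((div_lt_one h2).2 hr)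
  have e1 : Real.exp (-2 * kMinus M e * r) = (Real.exp (2 * kMinus M e * r))⁻¹ := by
    rw [← Real.exp_neg]; ring_nf
  have e2 : (1 - r / rPlus M e) ^ (-(kMinus M e / kPlus M e)) *
      (1 - r / rPlus M e) ^ (1 + kMinus M e / kPlus M e) = 1 - r / rPlus M e := by
    rw [← Real.rpow_add h4]; simp
  have hE := (Real.exp_pos (2 * kMinus M e * r)).ne'
  calc radialMinus M e r * quotMinus M e r
      = (1 - r / rMinus M e) * (Real.exp (-2 * kMinus M e * r) * Real.exp (2 * kMinus M e * r)) *
        (rPlus M e * rMinus M e / r ^ 2) * ((1 - r / rPlus M e) ^ (-(kMinus M e / kPlus M e)) *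
      (1 - r / rPlus M e) ^ (1 + kMinus M e / kPlus M e)) := by rw [radialMinus, quotMinus]; ring
    _ = _ := by rw [e2, e1, inv_mul_cancel₀ hE]; ring

/-- Between the horizons, `radialPlus r = -exp (2 κ₊ r*)` and `radialMinus r = -exp (-2 κ₋ r*)`. -/
lemma radialMinus_eq_of_radialPlus_eq (hM : 0 < M) (he : 0 < e ^ 2) (heM : e ^ 2 < M ^ 2)
    (hr : rMinus M e < r) {s : ℝ} (hs : radialPlus M e r = -Real.exp (kPlus M e * s)) :
    r < rPlus M e ∧ radialMinus M e r = -Real.exp (-kMinus M e * s) := by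
  have h1 := rMinus_pos hM he
  have h2 := rPlus_pos (e := e) hM
  have hz : 0 < r / rMinus M e - 1 := sub_pos.2 ((one_lt_div h1).2 hr)
  have hkp := kPlus_pos hM heM
  have hkm := kMinus_pos hM he heM
  have hA := Real.rpow_pos_of_pos hz (-(kPlus M e / kMinus M e))
  have hE := Real.exp_pos (2 * kPlus M e * r)
  have hrp : r < rPlus M e := by
    by_contra hc
    have : 0 ≤ r / rPlus M e - 1 := sub_nonneg.2 ((one_le_div h2).2 (not_lt.1 hc))
    have h3 : 0 ≤ radialPlus M e r := by unfold radialPlus; positivity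
    linarith [Real.exp_pos (kPlus M e * s)]
  have hy : 0 < 1 - r / rPlus M e := sub_pos.2 ((div_lt_one h2).2 hrp)
  refine ⟨hrp, ?_⟩
  have hlog : Real.log (1 - r / rPlus M e) + 2 * kPlus M e * r
      - kPlus M e / kMinus M e * Real.log (r / rMinus M e - 1) = kPlus M e * s := by
    have h5 : (1 - r / rPlus M e) * Real.exp (2 * kPlus M e * r) *
        (r / rMinus M e - 1) ^ (-(kPlus M e / kMinus M e)) = Real.exp (kPlus M e * s) := by
      rw [radialPlus] at hs; linarith
    have h6 := congrArg Real.log h5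
    rw [Real.log_exp, Real.log_mul (by positivity) hA.ne', Real.log_mul hy.ne' hE.ne',
      Real.log_exp, Real.log_rpow hz] at h6
    linarith
  -- Both relations say `2 r* = s`; this one is `hlog` multiplied by `-κ₋ / κ₊`.
  have hgoal : Real.log (r / rMinus M e - 1) + -2 * kMinus M e * r
      + -(kMinus M e / kPlus M e) * Real.log (1 - r / rPlus M e) = -kMinus M e * s := by
    field_simp at hlog ⊢
    linarith
  rw [← hgoal, Real.exp_add, Real.exp_add, Real.exp_log hz, radialMinus,
    Real.rpow_def_of_pos hy, mul_comm (Real.log (1 - r / rPlus M e))]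
  ring

end ReissnerNordstrom

namespace ReissnerNordstrom
open Filter Topology

variable {M e : ℝ} {F : ℝ → ℝ} {r v w : ℝ}

/-! ### The Kruskal coordinates of a profile -/

lemma sign_mul_sign_eq_one {a b : ℝ} (h : 0 < a * b) : Real.sign a * Real.sign b = 1 := by
  rcases pos_and_pos_or_neg_and_neg_of_mul_pos h with ⟨ha, hb⟩ | ⟨ha, hb⟩
  · rw [Real.sign_of_pos ha, Real.sign_of_pos hb, one_mul]
  · rw [Real.sign_of_neg ha, Real.sign_of_neg hb]; norm_num

lemma sign_neg_one_zpow_mul (k : ℤ) (s : ℝ) :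
    Real.sign ((-1) ^ k * s) = (-1) ^ k * Real.sign s := by
  rcases Int.even_or_odd k with hk | hk
  · simp [hk.neg_one_zpow]
  · simp [hk.neg_one_zpow, Real.sign_neg]

lemma neg_one_zpow_mul_self (k : ℤ) : ((-1 : ℝ) ^ k) * (-1) ^ k = 1 := by
  rcases Int.even_or_odd k with hk | hk
  · simp [hk.neg_one_zpow]
  · simp [hk.neg_one_zpow]

lemma IsPenroseProfile.sub_int_mul (hF : IsPenroseProfile M e F) (k : ℤ) (v : ℝ) :
    F (v - k * (2 * Real.pi)) = F v :=
  Function.Periodic.sub_int_mul_eq hF.periodic k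

/-- A period of `F` flips the sign of `sin (v / 2)`. This carries the regularity from the
fundamental interval to all others; the signs cancel in products over `v` and `w`, the only form in
which `r` and `Ω²` use the coordinates. -/
lemma IsPenroseProfile.xPlus_eq (hF : IsPenroseProfile M e F) (k : ℤ) (v : ℝ) :
    xPlus M e F v = (-1) ^ k * xPlus M e F (v - k * (2 * Real.pi)) := by
  have h1 : (v - k * (2 * Real.pi)) / 2 = v / 2 - k * Real.pi := by ring
  rw [xPlus, xPlus, hF.sub_int_mul, h1, Real.sin_sub_int_mul_pi, sign_neg_one_zpow_mul,
    ← mul_assoc, ← mul_assoc, neg_one_zpow_mul_self, one_mul]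

lemma IsPenroseProfile.xMinus_eq (hF : IsPenroseProfile M e F) (k : ℤ) (v : ℝ) :
    xMinus M e F v = (-1) ^ k * xMinus M e F (v - k * (2 * Real.pi)) := by
  have h1 : (v - k * (2 * Real.pi)) / 2 = v / 2 - k * Real.pi := by ring
  rw [xMinus, xMinus, hF.sub_int_mul, h1, Real.cos_sub_int_mul_pi, sign_neg_one_zpow_mul]
  linear_combination (Real.sign (Real.cos (v / 2)) * Real.exp (-kMinus M e * F v)) *
    neg_one_zpow_mul_self k

lemma sub_mem_Ioo_neg_pi_pi {k : ℤ} (hv : v ∈ Ioo ((2 * k - 1) * Real.pi) ((2 * k + 1) * Real.pi)) :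
    v - k * (2 * Real.pi) ∈ Ioo (-Real.pi) Real.pi :=
  ⟨by linarith [hv.1], by linarith [hv.2]⟩

lemma sub_mem_Ioo_zero_two_pi {k : ℤ} (hv : v ∈ Ioo (2 * k * Real.pi) ((2 * k + 2) * Real.pi)) :
    v - k * (2 * Real.pi) ∈ Ioo 0 (2 * Real.pi) :=
  ⟨by linarith [hv.1], by linarith [hv.2]⟩

lemma IsPenroseProfile.contDiffAt_xPlus (hF : IsPenroseProfile M e F) {k : ℤ}
    (hv : v ∈ Ioo ((2 * k - 1) * Real.pi) ((2 * k + 1) * Real.pi)) :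
    ContDiffAt ℝ ∞ (xPlus M e F) v := by
  have hv' := sub_mem_Ioo_neg_pi_pi hv
  have h1 := hF.smooth_plus.contDiffAt (isOpen_Ioo.mem_nhds hv')
  rw [show xPlus M e F = fun v => (-1) ^ k * xPlus M e F (v - k * (2 * Real.pi)) from
    funext (hF.xPlus_eq k)]
  exact contDiffAt_const.mul (h1.comp (f := fun v => v - k * (2 * Real.pi)) v (by fun_prop))

lemma IsPenroseProfile.contDiffAt_xMinus (hF : IsPenroseProfile M e F) {k : ℤ}
    (hv : v ∈ Ioo (2 * k * Real.pi) ((2 * k + 2) * Real.pi)) :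
    ContDiffAt ℝ ∞ (xMinus M e F) v := by
  have hv' := sub_mem_Ioo_zero_two_pi hv
  have h1 := hF.smooth_minus.contDiffAt (isOpen_Ioo.mem_nhds hv')
  rw [show xMinus M e F = fun v => (-1) ^ k * xMinus M e F (v - k * (2 * Real.pi)) from
    funext (hF.xMinus_eq k)]
  exact contDiffAt_const.mul (h1.comp (f := fun v => v - k * (2 * Real.pi)) v (by fun_prop))

lemma IsPenroseProfile.deriv_xPlus_eq (hF : IsPenroseProfile M e F) (k : ℤ) (v : ℝ) :
    deriv (xPlus M e F) v = (-1) ^ k * deriv (xPlus M e F) (v - k * (2 * Real.pi)) := by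
  conv_lhs => rw [show xPlus M e F = fun v => (-1) ^ k * xPlus M e F (v - k * (2 * Real.pi)) from
    funext (hF.xPlus_eq k)]
  rw [deriv_const_mul_field, deriv_comp_sub_const]

lemma IsPenroseProfile.deriv_xMinus_eq (hF : IsPenroseProfile M e F) (k : ℤ) (v : ℝ) :
    deriv (xMinus M e F) v = (-1) ^ k * deriv (xMinus M e F) (v - k * (2 * Real.pi)) := by
  conv_lhs => rw [show xMinus M e F = fun v => (-1) ^ k * xMinus M e F (v - k * (2 * Real.pi)) from
    funext (hF.xMinus_eq k)]
  rw [deriv_const_mul_field, deriv_comp_sub_const]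

lemma IsPenroseProfile.deriv_xPlus_mul_pos (hF : IsPenroseProfile M e F) (h : PlusPatch v w) :
    0 < deriv (xPlus M e F) v * deriv (xPlus M e F) w := by
  obtain ⟨k, hv, hw⟩ := h
  rw [hF.deriv_xPlus_eq k v, hF.deriv_xPlus_eq k w, mul_mul_mul_comm, neg_one_zpow_mul_self,
    one_mul]
  exact mul_pos (hF.deriv_plus_pos _ (sub_mem_Ioo_neg_pi_pi hv))
    (hF.deriv_plus_pos _ (sub_mem_Ioo_neg_pi_pi hw))

lemma IsPenroseProfile.deriv_xMinus_mul_pos (hF : IsPenroseProfile M e F) (h : MinusPatch v w) :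
    0 < deriv (xMinus M e F) v * deriv (xMinus M e F) w := by
  obtain ⟨k, hv, hw⟩ := h
  rw [hF.deriv_xMinus_eq k v, hF.deriv_xMinus_eq k w, mul_mul_mul_comm, neg_one_zpow_mul_self,
    one_mul]
  exact mul_pos (hF.deriv_minus_pos _ (sub_mem_Ioo_zero_two_pi hv))
    (hF.deriv_minus_pos _ (sub_mem_Ioo_zero_two_pi hw))

/-- In a patch around `r = r₊` it is the sign of the other coordinate `x₋` that is constant. On
overlaps this makes `x₋(v) x₋(w)` a pure exponential. -/
lemma PlusPatch.cos_mul_cos_pos (h : PlusPatch v w) : 0 < Real.cos (v / 2) * Real.cos (w / 2) := by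
  obtain ⟨k, hv, hw⟩ := h
  have key : ∀ x ∈ Ioo ((2 * k - 1) * Real.pi) ((2 * k + 1) * Real.pi),
      0 < (-1) ^ k * Real.cos (x / 2) := by
    intro x hx
    rw [← Real.cos_sub_int_mul_pi]
    exact Real.cos_pos_of_mem_Ioo ⟨by linarith [hx.1], by linarith [hx.2]⟩
  have := mul_pos (key v hv) (key w hw)
  rwa [mul_mul_mul_comm, neg_one_zpow_mul_self, one_mul] at this

lemma MinusPatch.sin_mul_sin_pos (h : MinusPatch v w) :
    0 < Real.sin (v / 2) * Real.sin (w / 2) := by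
  obtain ⟨k, hv, hw⟩ := h
  have key : ∀ x ∈ Ioo (2 * k * Real.pi) ((2 * k + 2) * Real.pi),
      0 < (-1) ^ k * Real.sin (x / 2) := by
    intro x hx
    rw [← Real.sin_sub_int_mul_pi]
    exact Real.sin_pos_of_mem_Ioo ⟨by linarith [hx.1], by linarith [hx.2]⟩
  have := mul_pos (key v hv) (key w hw)
  rwa [mul_mul_mul_comm, neg_one_zpow_mul_self, one_mul] at this

lemma xPlus_mul_xPlus (h : 0 < Real.sin (v / 2) * Real.sin (w / 2)) :
    xPlus M e F v * xPlus M e F w = Real.exp (kPlus M e * (F v + F w)) := by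
  rw [xPlus, xPlus, mul_mul_mul_comm, sign_mul_sign_eq_one h, one_mul, ← Real.exp_add, mul_add]

lemma xMinus_mul_xMinus (h : 0 < Real.cos (v / 2) * Real.cos (w / 2)) :
    xMinus M e F v * xMinus M e F w = Real.exp (-kMinus M e * (F v + F w)) := by
  rw [xMinus, xMinus, mul_mul_mul_comm, neg_mul_neg, sign_mul_sign_eq_one h, one_mul,
    ← Real.exp_add, mul_add]

lemma sign_ne_zero {s : ℝ} (hs : s ≠ 0) : Real.sign s ≠ 0 := fun h => hs (Real.sign_eq_zero_iff.1 h)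

lemma abs_sign {s : ℝ} (hs : s ≠ 0) : |Real.sign s| = 1 := by
  rcases Real.sign_apply_eq_of_ne_zero s hs with h | h <;> simp [h]

/-- Off the horizons, where `xPlus` is differentiable, so is the profile. -/
lemma hasDerivAt_of_xPlus (hM : 0 < M) (heM : e ^ 2 < M ^ 2) (hs : Real.sin (v / 2) ≠ 0)
    (hx : DifferentiableAt ℝ (xPlus M e F) v) :
    HasDerivAt F (deriv (xPlus M e F) v / xPlus M e F v / kPlus M e) v := by
  have hk := kPlus_pos hM heM
  have h0 : xPlus M e F v ≠ 0 := mul_ne_zero (sign_ne_zero hs) (Real.exp_pos _).ne'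
  have h1 := (hx.hasDerivAt.log h0).div_const (kPlus M e)
  refine h1.congr_of_eventuallyEq ?_
  have hc : ContinuousAt (fun v : ℝ => Real.sin (v / 2)) v := by fun_prop
  filter_upwards [hc.eventually_ne hs] with y hy
  rw [← Real.log_abs, xPlus, abs_mul, abs_sign hy, one_mul, Real.abs_exp, Real.log_exp,
    mul_div_cancel_left₀ _ hk.ne']

lemma hasDerivAt_of_xMinus (hM : 0 < M) (he : 0 < e ^ 2) (heM : e ^ 2 < M ^ 2)
    (hs : Real.cos (v / 2) ≠ 0) (hx : DifferentiableAt ℝ (xMinus M e F) v) :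
    HasDerivAt F (-(deriv (xMinus M e F) v / xMinus M e F v / kMinus M e)) v := by
  have hk := kMinus_pos hM he heM
  have h0 : xMinus M e F v ≠ 0 :=
    mul_ne_zero (neg_ne_zero.2 (sign_ne_zero hs)) (Real.exp_pos _).ne'
  have h1 := ((hx.hasDerivAt.log h0).div_const (kMinus M e)).neg
  refine h1.congr_of_eventuallyEq ?_
  have hc : ContinuousAt (fun v : ℝ => Real.cos (v / 2)) v := by fun_prop
  filter_upwards [hc.eventually_ne hs] with y hy
  rw [Pi.neg_apply, ← Real.log_abs, xMinus, abs_mul, abs_neg, abs_sign hy, one_mul, Real.abs_exp,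
    Real.log_exp, neg_mul, neg_div, mul_div_cancel_left₀ _ hk.ne', neg_neg]

/-! ### Radius and conformal factor -/

/-- The radius in a patch around a sphere `r = r₋`. -/
noncomputable def radiusMinus (M e : ℝ) (F : ℝ → ℝ) (v w : ℝ) : ℝ :=
  Function.invFunOn (radialMinus M e) (Ioo 0 (rPlus M e)) (-(xMinus M e F v * xMinus M e F w))

/-- The radius in a patch around a sphere `r = r₊`. -/
noncomputable def radiusPlus (M e : ℝ) (F : ℝ → ℝ) (v w : ℝ) : ℝ :=
  Function.invFunOn (radialPlus M e) (Ioi (rMinus M e)) (-(xPlus M e F v * xPlus M e F w))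

lemma radiusPlus_mem (hM : 0 < M) (he : 0 < e ^ 2) (heM : e ^ 2 < M ^ 2) (v w : ℝ) :
    rMinus M e < radiusPlus M e F v w :=
  Function.invFunOn_mem (surjOn_radialPlus hM he heM (mem_univ _))

lemma radialPlus_radiusPlus (hM : 0 < M) (he : 0 < e ^ 2) (heM : e ^ 2 < M ^ 2) (v w : ℝ) :
    radialPlus M e (radiusPlus M e F v w) = -(xPlus M e F v * xPlus M e F w) :=
  Function.invFunOn_eq (surjOn_radialPlus hM he heM (mem_univ _))

lemma radiusMinus_mem (hM : 0 < M) (he : 0 < e ^ 2) (heM : e ^ 2 < M ^ 2)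
    (h : -(xMinus M e F v * xMinus M e F w) < 1) :
    radiusMinus M e F v w ∈ Ioo 0 (rPlus M e) :=
  Function.invFunOn_mem (surjOn_radialMinus hM he heM h)

lemma radialMinus_radiusMinus (hM : 0 < M) (he : 0 < e ^ 2) (heM : e ^ 2 < M ^ 2)
    (h : -(xMinus M e F v * xMinus M e F w) < 1) :
    radialMinus M e (radiusMinus M e F v w) = -(xMinus M e F v * xMinus M e F w) :=
  Function.invFunOn_eq (surjOn_radialMinus hM he heM h)

lemma radius_of_plusPatch (h : PlusPatch v w) : radius M e F v w = radiusPlus M e F v w :=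
  if_pos h

lemma confFactor_of_plusPatch (h : PlusPatch v w) : confFactor M e F v w =
    quotPlus M e (radiusPlus M e F v w) * deriv (xPlus M e F) v * deriv (xPlus M e F) w
      / kPlus M e ^ 2 := by
  rw [confFactor, if_pos h, radius_of_plusPatch h]

/-- Patches overlap only in blocks between the horizons, where both defining equations say `r* = (F
v + F w) / 2`. -/
lemma radiusPlus_eq_radiusMinus (hM : 0 < M) (he : 0 < e ^ 2) (heM : e ^ 2 < M ^ 2)
    (hp : PlusPatch v w) (hm : MinusPatch v w) :
    radiusPlus M e F v w < rPlus M e ∧ radiusPlus M e F v w = radiusMinus M e F v w := by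
  have h1 := radiusPlus_mem (F := F) hM he heM v w
  have h2 := radialPlus_radiusPlus (F := F) hM he heM v w
  rw [xPlus_mul_xPlus hm.sin_mul_sin_pos] at h2
  obtain ⟨h3, h4⟩ := radialMinus_eq_of_radialPlus_eq hM he heM h1 h2
  rw [← xMinus_mul_xMinus hp.cos_mul_cos_pos] at h4
  have hmem : radiusPlus M e F v w ∈ Ioo 0 (rPlus M e) := ⟨(rMinus_pos hM he).trans h1, h3⟩
  have hex : ∃ r ∈ Ioo 0 (rPlus M e), radialMinus M e r = -(xMinus M e F v * xMinus M e F w) :=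
    ⟨_, hmem, h4⟩
  exact ⟨h3, injOn_radialMinus hM he heM hmem (Function.invFunOn_mem hex)
    (h4.trans (Function.invFunOn_eq hex).symm)⟩

lemma radius_of_minusPatch (hM : 0 < M) (he : 0 < e ^ 2) (heM : e ^ 2 < M ^ 2)
    (hm : MinusPatch v w) : radius M e F v w = radiusMinus M e F v w := by
  by_cases hp : PlusPatch v w
  · rw [radius_of_plusPatch hp, (radiusPlus_eq_radiusMinus hM he heM hp hm).2]
  · exact if_neg hp

/-- On an overlap both expressions equal `-h F'(v) F'(w)`, because `x₊' = κ₊ F' x₊`, `x₋' = -κ₋ F'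
x₋`, and each radial function times its quotient is `h`. -/
lemma confFactor_of_minusPatch (hM : 0 < M) (he : 0 < e ^ 2) (heM : e ^ 2 < M ^ 2)
    (hF : IsPenroseProfile M e F) (hm : MinusPatch v w) :
    confFactor M e F v w =
      quotMinus M e (radiusMinus M e F v w) * deriv (xMinus M e F) v * deriv (xMinus M e F) w
        / kMinus M e ^ 2 := by
  by_cases hp : PlusPatch v w
  · obtain ⟨hlt, heq⟩ := radiusPlus_eq_radiusMinus (F := F) hM he heM hp hm
    have hgt := radiusPlus_mem (F := F) hM he heM v w
    have hsin := hm.sin_mul_sin_pos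
    have hcos := hp.cos_mul_cos_pos
    have key : ∀ x, Real.sin (x / 2) ≠ 0 → Real.cos (x / 2) ≠ 0 →
        DifferentiableAt ℝ (xPlus M e F) x → DifferentiableAt ℝ (xMinus M e F) x →
        deriv (xPlus M e F) x = kPlus M e * deriv F x * xPlus M e F x ∧
        deriv (xMinus M e F) x = -kMinus M e * deriv F x * xMinus M e F x := by
      intro x hs hc hxp hxm
      have hk := (kPlus_pos hM heM).ne'
      have hk' := (kMinus_pos hM he heM).ne'
      have h0 : xPlus M e F x ≠ 0 := mul_ne_zero (sign_ne_zero hs) (Real.exp_pos _).ne'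
      have h0' : xMinus M e F x ≠ 0 :=
        mul_ne_zero (neg_ne_zero.2 (sign_ne_zero hc)) (Real.exp_pos _).ne'
      constructor
      · rw [(hasDerivAt_of_xPlus hM heM hs hxp).deriv]
        field_simp
      · rw [(hasDerivAt_of_xMinus hM he heM hc hxm).deriv]
        field_simp
    have hdp : DifferentiableAt ℝ (xPlus M e F) v ∧ DifferentiableAt ℝ (xPlus M e F) w := by
      obtain ⟨k, hv, hw⟩ := hp
      exact ⟨(hF.contDiffAt_xPlus hv).differentiableAt (by simp),
        (hF.contDiffAt_xPlus hw).differentiableAt (by simp)⟩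
    have hdm : DifferentiableAt ℝ (xMinus M e F) v ∧ DifferentiableAt ℝ (xMinus M e F) w := by
      obtain ⟨k, hv, hw⟩ := hm
      exact ⟨(hF.contDiffAt_xMinus hv).differentiableAt (by simp),
        (hF.contDiffAt_xMinus hw).differentiableAt (by simp)⟩
    obtain ⟨a1, a2⟩ := key v (left_ne_zero_of_mul hsin.ne') (left_ne_zero_of_mul hcos.ne')
      hdp.1 hdm.1
    obtain ⟨b1, b2⟩ := key w (right_ne_zero_of_mul hsin.ne') (right_ne_zero_of_mul hcos.ne')
      hdp.2 hdm.2
    have hk := (kPlus_pos hM heM).ne'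
    have hk' := (kMinus_pos hM he heM).ne'
    have q1 := radialPlus_mul_quotPlus hM he hgt
    have q2 := radialMinus_mul_quotMinus (e := e) hM hlt
    have q3 : radialMinus M e (radiusPlus M e F v w) = -(xMinus M e F v * xMinus M e F w) := by
      have h2 := radialPlus_radiusPlus (F := F) hM he heM v w
      rw [xPlus_mul_xPlus hsin] at h2
      rw [(radialMinus_eq_of_radialPlus_eq hM he heM hgt h2).2, xMinus_mul_xMinus hcos]
    rw [← q2, q3, radialPlus_radiusPlus hM he heM] at q1
    rw [confFactor_of_plusPatch hp, ← heq, a1, a2, b1, b2]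
    field_simp
    linear_combination (-deriv F v * deriv F w) * q1
  · rw [confFactor, if_neg hp, radius_of_minusPatch hM he heM hm]

lemma isOpen_plusPatch : IsOpen {z : ℝ × ℝ | PlusPatch z.1 z.2} := by
  have : {z : ℝ × ℝ | PlusPatch z.1 z.2} = ⋃ k : ℤ,
      Ioo ((2 * k - 1) * Real.pi) ((2 * k + 1) * Real.pi) ×ˢ
        Ioo ((2 * k - 1) * Real.pi) ((2 * k + 1) * Real.pi) := by
    ext z; simp [PlusPatch]
  rw [this]
  exact isOpen_iUnion fun k => isOpen_Ioo.prod isOpen_Ioo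

lemma isOpen_minusPatch : IsOpen {z : ℝ × ℝ | MinusPatch z.1 z.2} := by
  have : {z : ℝ × ℝ | MinusPatch z.1 z.2} = ⋃ k : ℤ,
      Ioo (2 * k * Real.pi) ((2 * k + 2) * Real.pi) ×ˢ
        Ioo (2 * k * Real.pi) ((2 * k + 2) * Real.pi) := by
    ext z; simp [MinusPatch]
  rw [this]
  exact isOpen_iUnion fun k => isOpen_Ioo.prod isOpen_Ioo

/-- The diagram in null coordinates. -/
def nullDiagram (M e : ℝ) (F : ℝ → ℝ) : Set (ℝ × ℝ) :=
  {z | PlusPatch z.1 z.2 ∨ (MinusPatch z.1 z.2 ∧ -(xMinus M e F z.1 * xMinus M e F z.2) < 1)}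

lemma IsPenroseProfile.contDiffAt_xPlus_mul (hF : IsPenroseProfile M e F) {z : ℝ × ℝ}
    (h : PlusPatch z.1 z.2) :
    ContDiffAt ℝ ∞ (fun z : ℝ × ℝ => -(xPlus M e F z.1 * xPlus M e F z.2)) z := by
  obtain ⟨k, hv, hw⟩ := h
  exact (((hF.contDiffAt_xPlus hv).comp z contDiffAt_fst).mul
    ((hF.contDiffAt_xPlus hw).comp z contDiffAt_snd)).neg

lemma IsPenroseProfile.contDiffAt_xMinus_mul (hF : IsPenroseProfile M e F) {z : ℝ × ℝ}
    (h : MinusPatch z.1 z.2) :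
    ContDiffAt ℝ ∞ (fun z : ℝ × ℝ => -(xMinus M e F z.1 * xMinus M e F z.2)) z := by
  obtain ⟨k, hv, hw⟩ := h
  exact (((hF.contDiffAt_xMinus hv).comp z contDiffAt_fst).mul
    ((hF.contDiffAt_xMinus hw).comp z contDiffAt_snd)).neg

lemma isOpen_nullDiagram (hF : IsPenroseProfile M e F) : IsOpen (nullDiagram M e F) := by
  rw [isOpen_iff_mem_nhds]
  rintro z (h | ⟨h, h'⟩)
  · exact mem_of_superset (isOpen_plusPatch.mem_nhds h) fun y hy => Or.inl hy
  · filter_upwards [isOpen_minusPatch.mem_nhds h,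
      (hF.contDiffAt_xMinus_mul h).continuousAt (Iio_mem_nhds h')] with y hy hy'
    exact Or.inr ⟨hy, hy'⟩

lemma contDiffAt_deriv {f : ℝ → ℝ} {x : ℝ} (hf : ContDiffAt ℝ ∞ f x) :
    ContDiffAt ℝ ∞ (deriv f) x :=
  (hf.fderiv_right (m := ∞) (by simp)).clm_apply contDiffAt_const

end ReissnerNordstrom

/-! ### Smoothness on the whole diagram and reduction to the slope equation. -/

namespace ReissnerNordstrom
open Filter Topology

variable {M e : ℝ} {F : ℝ → ℝ}

/-- The radius and the conformal factor are smooth and positive on the diagram. -/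
lemma contDiffAt_radius_confFactor (hM : 0 < M) (he : 0 < e ^ 2) (heM : e ^ 2 < M ^ 2)
    (hF : IsPenroseProfile M e F) {z : ℝ × ℝ} (hz : z ∈ nullDiagram M e F) :
    (ContDiffAt ℝ ∞ (fun z : ℝ × ℝ => radius M e F z.1 z.2) z ∧ 0 < radius M e F z.1 z.2) ∧
    ContDiffAt ℝ ∞ (fun z : ℝ × ℝ => confFactor M e F z.1 z.2) z ∧
      0 < confFactor M e F z.1 z.2 := by
  rcases hz with h | ⟨h, h'⟩
  · have hmem := radiusPlus_mem (F := F) hM he heM z.1 z.2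
    have heq := radialPlus_radiusPlus (F := F) hM he heM z.1 z.2
    have hev := isOpen_plusPatch.mem_nhds h
    have hk := kPlus_pos hM heM
    have hr : ContDiffAt ℝ ∞ (fun z : ℝ × ℝ => radiusPlus M e F z.1 z.2) z := by
      have h1 := contDiffAt_invFunOn isOpen_Ioi hmem (injOn_radialPlus hM he heM)
        (contDiffAt_radialPlus hM he hmem) (by simp)
        (by
          rw [(hasDerivAt_radialPlus hM he heM hmem).deriv]
          have := quotPlus_pos hM he hmem
          positivity)
      rw [heq] at h1
      exact h1.comp z (hF.contDiffAt_xPlus_mul h)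
    have hq : ContDiffAt ℝ ∞ (fun z : ℝ × ℝ => quotPlus M e (radiusPlus M e F z.1 z.2)) z :=
      ContDiffAt.comp (f := fun z : ℝ × ℝ => radiusPlus M e F z.1 z.2) z
        (contDiffAt_quotPlus hM he hmem) hr
    have hd : ContDiffAt ℝ ∞ (fun z : ℝ × ℝ => deriv (xPlus M e F) z.1) z ∧
        ContDiffAt ℝ ∞ (fun z : ℝ × ℝ => deriv (xPlus M e F) z.2) z := by
      obtain ⟨k, hv, hw⟩ := h
      exact ⟨(contDiffAt_deriv (hF.contDiffAt_xPlus hv)).comp z contDiffAt_fst,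
        (contDiffAt_deriv (hF.contDiffAt_xPlus hw)).comp z contDiffAt_snd⟩
    refine ⟨⟨hr.congr_of_eventuallyEq ?_, ?_⟩,
      (((hq.mul hd.1).mul hd.2).div_const (kPlus M e ^ 2)).congr_of_eventuallyEq ?_, ?_⟩
    · filter_upwards [hev] with y hy
      exact radius_of_plusPatch hy
    · rw [radius_of_plusPatch h]
      exact (rMinus_pos hM he).trans hmem
    · filter_upwards [hev] with y hy
      exact confFactor_of_plusPatch hy
    · rw [confFactor_of_plusPatch h, mul_assoc]
      exact div_pos (mul_pos (quotPlus_pos hM he hmem) (hF.deriv_xPlus_mul_pos h)) (pow_pos hk 2)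
  · have hmem := radiusMinus_mem (F := F) hM he heM h'
    have heq := radialMinus_radiusMinus (F := F) hM he heM h'
    have hev := isOpen_minusPatch.mem_nhds h
    have hk := kMinus_pos hM he heM
    have hr : ContDiffAt ℝ ∞ (fun z : ℝ × ℝ => radiusMinus M e F z.1 z.2) z := by
      have h1 := contDiffAt_invFunOn isOpen_Ioo hmem (injOn_radialMinus hM he heM)
        (contDiffAt_radialMinus hM hmem.2) (by simp)
        (by
          rw [(hasDerivAt_radialMinus hM he heM hmem.1 hmem.2).deriv, neg_ne_zero]
          have := quotMinus_pos hM he hmem.1 hmem.2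
          positivity)
      rw [heq] at h1
      exact h1.comp z (hF.contDiffAt_xMinus_mul h)
    have hq : ContDiffAt ℝ ∞ (fun z : ℝ × ℝ => quotMinus M e (radiusMinus M e F z.1 z.2)) z :=
      ContDiffAt.comp (f := fun z : ℝ × ℝ => radiusMinus M e F z.1 z.2) z
        (contDiffAt_quotMinus hM hmem.1 hmem.2) hr
    have hd : ContDiffAt ℝ ∞ (fun z : ℝ × ℝ => deriv (xMinus M e F) z.1) z ∧
        ContDiffAt ℝ ∞ (fun z : ℝ × ℝ => deriv (xMinus M e F) z.2) z := by
      obtain ⟨k, hv, hw⟩ := h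
      exact ⟨(contDiffAt_deriv (hF.contDiffAt_xMinus hv)).comp z contDiffAt_fst,
        (contDiffAt_deriv (hF.contDiffAt_xMinus hw)).comp z contDiffAt_snd⟩
    refine ⟨⟨hr.congr_of_eventuallyEq ?_, ?_⟩,
      (((hq.mul hd.1).mul hd.2).div_const (kMinus M e ^ 2)).congr_of_eventuallyEq ?_, ?_⟩
    -- Points near an inner horizon may also lie in a plus patch, where the radius is defined by the
    -- other formula; agreement on overlaps covers them.
    · filter_upwards [hev] with y hy
      exact radius_of_minusPatch hM he heM hy
    · rw [radius_of_minusPatch hM he heM h]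
      exact hmem.1
    · filter_upwards [hev] with y hy
      exact confFactor_of_minusPatch hM he heM hF hy
    · rw [confFactor_of_minusPatch hM he heM hF h, mul_assoc]
      exact div_pos (mul_pos (quotMinus_pos hM he hmem.1 hmem.2) (hF.deriv_xMinus_mul_pos h))
        (pow_pos hk 2)

/-- The conformal factor as a function of `(T, X)`. -/
noncomputable def confFactorTX (M e : ℝ) (F : ℝ → ℝ) (p : ℝ × ℝ) : ℝ :=
  confFactor M e F (p.1 + p.2) (p.1 - p.2)

/-- The radius as a function of `(T, X)`. -/
noncomputable def radiusTX (M e : ℝ) (F : ℝ → ℝ) (p : ℝ × ℝ) : ℝ :=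
  radius M e F (p.1 + p.2) (p.1 - p.2)

lemma metric_eq_sphericalMetric :
    metric M e F = LorentzChart.sphericalMetric (confFactorTX M e F) (radiusTX M e F) := rfl

lemma isOpen_penroseDiagram (hF : IsPenroseProfile M e F) : IsOpen (penroseDiagram M e F) :=
  (isOpen_nullDiagram hF).preimage
    (by fun_prop : Continuous fun p : ℝ × ℝ => (p.1 + p.2, p.1 - p.2))

section Solution

variable {H T₀ X₀ V : ℝ} {J : Set ℝ} {S : ℝ → ℝ} {p : ℝ × ℝ}

lemma contDiffAt_confFactorTX (hM : 0 < M) (he : 0 < e ^ 2) (heM : e ^ 2 < M ^ 2)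
    (hF : IsPenroseProfile M e F) (hp : p ∈ penroseDiagram M e F) :
    ContDiffAt ℝ ∞ (confFactorTX M e F) p :=
  ContDiffAt.comp (f := fun p : ℝ × ℝ => (p.1 + p.2, p.1 - p.2)) p
    (contDiffAt_radius_confFactor hM he heM hF (z := (p.1 + p.2, p.1 - p.2)) hp).2.1 (by fun_prop)

lemma confFactorTX_pos (hM : 0 < M) (he : 0 < e ^ 2) (heM : e ^ 2 < M ^ 2)
    (hF : IsPenroseProfile M e F) (hp : p ∈ penroseDiagram M e F) : 0 < confFactorTX M e F p :=
  (contDiffAt_radius_confFactor hM he heM hF (z := (p.1 + p.2, p.1 - p.2)) hp).2.2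

lemma contDiffAt_radiusTX (hM : 0 < M) (he : 0 < e ^ 2) (heM : e ^ 2 < M ^ 2)
    (hF : IsPenroseProfile M e F) (hp : p ∈ penroseDiagram M e F) :
    ContDiffAt ℝ ∞ (radiusTX M e F) p :=
  ContDiffAt.comp (f := fun p : ℝ × ℝ => (p.1 + p.2, p.1 - p.2)) p
    (contDiffAt_radius_confFactor hM he heM hF (z := (p.1 + p.2, p.1 - p.2)) hp).1.1 (by fun_prop)

lemma radiusTX_pos (hM : 0 < M) (he : 0 < e ^ 2) (heM : e ^ 2 < M ^ 2)
    (hF : IsPenroseProfile M e F) (hp : p ∈ penroseDiagram M e F) : 0 < radiusTX M e F p :=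
  (contDiffAt_radius_confFactor hM he heM hF (z := (p.1 + p.2, p.1 - p.2)) hp).1.2

/-- The coefficient of `√(1 - T'²)` in the mean curvature equation. -/
noncomputable def curvatureCoeff (M e : ℝ) (F : ℝ → ℝ) (H : ℝ) (p : ℝ × ℝ) : ℝ :=
  3 * H * √(confFactorTX M e F p)

/-- The logarithmic derivative `-∂_ξ log (Ω r²)`. -/
noncomputable def logDerivCoeff (M e : ℝ) (F : ℝ → ℝ) (ξ : ℝ × ℝ) (p : ℝ × ℝ) : ℝ :=
  -(fderiv ℝ (confFactorTX M e F) p ξ / (2 * confFactorTX M e F p) +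
    2 * fderiv ℝ (radiusTX M e F) p ξ / radiusTX M e F p)

lemma contDiffOn_curvatureCoeff (hM : 0 < M) (he : 0 < e ^ 2) (heM : e ^ 2 < M ^ 2)
    (hF : IsPenroseProfile M e F) (H : ℝ) :
    ContDiffOn ℝ ∞ (curvatureCoeff M e F H) (penroseDiagram M e F) := fun _ hp =>
  (contDiffAt_const.mul ((contDiffAt_confFactorTX hM he heM hF hp).sqrt
    (confFactorTX_pos hM he heM hF hp).ne')).contDiffWithinAt

lemma contDiffOn_logDerivCoeff (hM : 0 < M) (he : 0 < e ^ 2) (heM : e ^ 2 < M ^ 2)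
    (hF : IsPenroseProfile M e F) (ξ : ℝ × ℝ) :
    ContDiffOn ℝ ∞ (logDerivCoeff M e F ξ) (penroseDiagram M e F) := by
  intro p hp
  have c1 := contDiffAt_confFactorTX hM he heM hF hp
  have c2 := contDiffAt_radiusTX hM he heM hF hp
  have d1 : ContDiffAt ℝ ∞ (fun p => fderiv ℝ (confFactorTX M e F) p ξ) p :=
    (c1.fderiv_right (m := ∞) (by simp)).clm_apply contDiffAt_const
  have d2 : ContDiffAt ℝ ∞ (fun p => fderiv ℝ (radiusTX M e F) p ξ) p :=
    (c2.fderiv_right (m := ∞) (by simp)).clm_apply contDiffAt_const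
  have n1 := confFactorTX_pos hM he heM hF hp
  have n2 := radiusTX_pos hM he heM hF hp
  exact ((d1.div (contDiffAt_const.mul c1) (by positivity)).add
    ((contDiffAt_const.mul d2).div c2 n2.ne')).neg.contDiffWithinAt

/-- The geometric problem is the initial value problem for the mean curvature equation. -/
lemma isSSCMCSolution_iff (hM : 0 < M) (he : 0 < e ^ 2) (heM : e ^ 2 < M ^ 2)
    (hF : IsPenroseProfile M e F) :
    IsSSCMCSolution M e F H T₀ X₀ V J S ↔
      SecondOrderODE.IsSlopeSolution (penroseDiagram M e F) (curvatureCoeff M e F H)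
        (logDerivCoeff M e F (1, 0)) (logDerivCoeff M e F (0, 1)) T₀ X₀ V J S := by
  have key : IsOpen J → ContDiffOn ℝ 2 S J → ∀ u : Fin 3 → ℝ, u 0 ∈ J → u 1 ∈ Ioo 0 Real.pi →
      (S (u 0), u 0) ∈ penroseDiagram M e F →
      (LorentzChart.SpacelikeAt (metric M e F) (graphMap S) u ↔ deriv S (u 0) ^ 2 < 1) ∧
      (deriv S (u 0) ^ 2 < 1 → (LorentzChart.HasMeanCurvatureAt (metric M e F) (graphMap S) u H ↔
        deriv (deriv S) (u 0) = SecondOrderODE.slopeRHS (curvatureCoeff M e F H)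
        (logDerivCoeff M e F (1, 0)) (logDerivCoeff M e F (0, 1))
        (S (u 0), u 0, deriv S (u 0)))) := by
    intro hJ hS u hu hu1 hmem
    have hd : ∀ᶠ X in 𝓝 (u 0), DifferentiableAt ℝ S X := by
      filter_upwards [hJ.mem_nhds hu] with X hX
      exact (hS.differentiableOn (by norm_num)).differentiableAt (hJ.mem_nhds hX)
    have h2 : ContDiffOn ℝ (1 + 1) S J := by simpa [one_add_one_eq_two] using hS
    have hd' : DifferentiableAt ℝ (deriv S) (u 0) :=
      (((contDiffOn_succ_iff_deriv_of_isOpen hJ).1 h2).2.2.differentiableOn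
        (by norm_num)).differentiableAt (hJ.mem_nhds hu)
    have hP := confFactorTX_pos hM he heM hF hmem
    have hR := radiusTX_pos hM he heM hF hmem
    have hs := Real.sin_pos_of_mem_Ioo hu1
    have h3 := LorentzChart.spacelikeAt_sphericalMetric_iff (P := confFactorTX M e F)
      (R := radiusTX M e F) (T := S) (u := u) hd.self_of_nhds hP hR hs
    have h4 := fun h1 => LorentzChart.hasMeanCurvatureAt_sphericalMetric_iff
      (P := confFactorTX M e F) (R := radiusTX M e F) (T := S) (u := u)
      ((contDiffAt_confFactorTX hM he heM hF hmem).differentiableAt (by simp))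
      ((contDiffAt_radiusTX hM he heM hF hmem).differentiableAt (by simp)) hd hd' hP hR hs h1 H
    rw [metric_eq_sphericalMetric]
    exact ⟨h3, h4⟩
  constructor
  · intro h
    have hmem : ∀ X ∈ J, (S X, X) ∈ penroseDiagram M e F := fun X hX =>
      h.mem_diagram (mem_image_of_mem _ hX)
    -- The resulting conditions do not involve the angles, so testing on the equator suffices.
    have hu1 : Real.pi / 2 ∈ Ioo 0 Real.pi := ⟨by positivity, by linarith [Real.pi_pos]⟩
    have hsl : ∀ X ∈ J, deriv S X ^ 2 < 1 := fun X hX =>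
      (key h.isOpen h.regular ![X, Real.pi / 2, 0] hX hu1 (hmem X hX)).1.1
        (h.spacelike _ hX hu1)
    exact ⟨h.isOpen, h.ordConnected, h.mem, h.regular, h.initial_value, h.initial_slope, hmem, hsl,
      fun X hX => ((key h.isOpen h.regular ![X, Real.pi / 2, 0] hX hu1 (hmem X hX)).2
        (hsl X hX)).1 (h.mean_curvature _ hX hu1)⟩
  · intro h
    refine ⟨h.isOpen, h.ordConnected, h.mem, h.regular, h.value, h.slope, ?_,
      fun u hu hu1 => (key h.isOpen h.regular u hu hu1 (h.mem_domain _ hu)).1.2 (h.slope_lt _ hu),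
      fun u hu hu1 => ((key h.isOpen h.regular u hu hu1 (h.mem_domain _ hu)).2
        (h.slope_lt _ hu)).2 (h.equation _ hu)⟩
    rintro _ ⟨X, hX, rfl⟩
    exact h.mem_domain X hX

end Solution

end ReissnerNordstrom

theorem theorem1 (M e : ℝ) (hM : 0 < M) (he : 0 < e ^ 2) (heM : e ^ 2 < M ^ 2)
    (F : ℝ → ℝ) (hF : ReissnerNordstrom.IsPenroseProfile M e F)
    (H T₀ X₀ V : ℝ) (hp : (T₀, X₀) ∈ ReissnerNordstrom.penroseDiagram M e F)
    (hV : 0 < 1 - V ^ 2) :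
    ∃ (I : Set ℝ) (T : ℝ → ℝ),
      ReissnerNordstrom.IsSSCMCSolution M e F H T₀ X₀ V I T ∧
      ContDiffOn ℝ ∞ T I ∧
      (∀ X ∈ I, 0 < 1 - deriv T X ^ 2) ∧
      (∀ p ∈ ReissnerNordstrom.penroseDiagram M e F,
        p ∈ closure (ReissnerNordstrom.graphOver I T) →
          p ∈ ReissnerNordstrom.graphOver I T) ∧
      ∀ (J : Set ℝ) (S : ℝ → ℝ),
        ReissnerNordstrom.IsSSCMCSolution M e F H T₀ X₀ V J S → J ⊆ I ∧ EqOn S T J := by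
  obtain ⟨I, T, hT, hsmooth, hcl, hmax⟩ := SecondOrderODE.exists_maximal_isSlopeSolution
    (ReissnerNordstrom.isOpen_penroseDiagram hF)
    (ReissnerNordstrom.contDiffOn_curvatureCoeff hM he heM hF H)
    (ReissnerNordstrom.contDiffOn_logDerivCoeff hM he heM hF (1, 0))
    (ReissnerNordstrom.contDiffOn_logDerivCoeff hM he heM hF (0, 1)) hp (sub_pos.1 hV)
  exact ⟨I, T, (ReissnerNordstrom.isSSCMCSolution_iff hM he heM hF).2 hT, hsmooth,
    fun X hX => sub_pos.2 (hT.slope_lt X hX), hcl,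
    fun J S hS => hmax J S ((ReissnerNordstrom.isSSCMCSolution_iff hM he heM hF).1 hS)⟩
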